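/- All graphs are simple and undirected. For finite graphs $F,G$, let $t(F,G)$ be the probability that a uniformly random mapping $V(F)\to V(G)$ is a graph homomorphism, and, when $|F|\le|G|$, let $t_{\mathrm{ind}}(F,G)$ be the probability that the subgraph of $G$ induced by a uniformly random set of $|F|$ vertices of $G$ is isomorphic to $F$. A sequence $(G_n)$ of finite graphs with $|G_n|\to\infty$ converges if $t(F,G_n)$ converges for every finite graph $F$. A graph limit $\Gamma$ is the limit object of such a sequence; it is determined by the numbers $t(F,\Gamma)=\lim_n t(F,G_n)$, and $G_n\to\Gamma$ means that $|G_n|\to\infty$ and $t(F,G_n)\to t(F,\Gamma)$ for every finite graph $F$. For each finite graph $F$, $t_{\mathrm{ind}}(F,\Gamma)$ denotes the common value of $\lim_n t_{\mathrm{ind}}(F,G_n)$ over all sequences $G_n\to\Gamma$. A unit interval graph is an intersection graph of closed intervals $[x,x+1]$, $x\in\mathbb R$ (distinct vertices are adjacent if and only if their intervals intersect). A unit interval graph limit is a graph limit $\Gamma$ such that $G_n\to\Gamma$ for some sequence $(G_n)$ of finite unit interval graphs. **Theorem.** A graph limit $\Gamma$ is a unit interval graph limit if and only if $t_{\mathrm{ind}}(F,\Gamma)=0$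 for every $$F\in\{C_k\}_{k\ge4}\cup\{K_{1,3},\,S_3,\,\overline{S}_3\},$$ where $C_k$ is the cycle on $k$ vertices, $S_3$ is the graph with vertex set $\{1,\dots,6\}$ and edge set $\{12,13,23,14,25,36\}$, and $\overline{S}_3$ is its complement. -/

import Mathlib

open Filter Topology

namespace IntervalLimits

/-- A finite graph, on the vertex set `{0, …, order - 1}`; every finite graph is isomorphic to one
of these. -/
structure FiniteGraph where
  order : ℕ
  graph : SimpleGraph (Fin order)

/-- `t(F, G)`: the probability that a uniformly random mapping `V(F) → V(G)` is a graph
homomorphism. -/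
noncomputable def homDensity (F G : FiniteGraph) : ℝ :=
  (Nat.card (F.graph →g G.graph) : ℝ) / (G.order : ℝ) ^ F.order

/-- `t_ind(F, G)`: the probability that the subgraph of `G` induced by a uniformly random set of
`|F|` vertices of `G` is isomorphic to `F` (meaningful for `|F| ≤ |G|`). -/
noncomputable def indDensity {W : Type*} [Fintype W] (F : SimpleGraph W) (G : FiniteGraph) : ℝ :=
  (Nat.card {S : Finset (Fin G.order) //
      S.card = Fintype.card W ∧ Nonempty (G.graph.induce (S : Set (Fin G.order)) ≃g F)} : ℝ) /
    (G.order.choose (Fintype.card W) : ℝ)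

/-- A (proper) graph limit: it is determined by the numbers `t(F, Γ)`, and these are exactly the
families that arise as the limits of `t(F, G n)` for a sequence of graphs with `|G n| → ∞`. -/
@[ext] structure GraphLimit where
  t : FiniteGraph → ℝ
  exists_seq : ∃ G : ℕ → FiniteGraph, Tendsto (fun n => (G n).order) atTop atTop ∧
    ∀ F : FiniteGraph, Tendsto (fun n => homDensity F (G n)) atTop (𝓝 (t F))

/-- `G n → Γ`: `|G n| → ∞` and `t(F, G n) → t(F, Γ)` for every finite graph `F`. -/
def ConvergesTo (G : ℕ → FiniteGraph) (Γ : GraphLimit) : Prop :=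
  Tendsto (fun n => (G n).order) atTop atTop ∧
    ∀ F : FiniteGraph, Tendsto (fun n => homDensity F (G n)) atTop (𝓝 (Γ.t F))

/-- A unit interval graph: an intersection graph of closed real intervals `[x, x + 1]`. -/
def IsUnitIntervalGraph {V : Type*} (G : SimpleGraph V) : Prop :=
  ∃ x : V → ℝ, ∀ v w : V, v ≠ w →
    (G.Adj v w ↔ (Set.Icc (x v) (x v + 1) ∩ Set.Icc (x w) (x w + 1)).Nonempty)

/-- A unit interval graph limit: a limit of some sequence of unit interval graphs. -/
def IsUnitIntervalGraphLimit (Γ : GraphLimit) : Prop :=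
  ∃ G : ℕ → FiniteGraph, (∀ n, IsUnitIntervalGraph (G n).graph) ∧ ConvergesTo G Γ

/-- The graph `S₃`: a triangle with a pendant edge attached at each of its three vertices. -/
def graphS3 : SimpleGraph (Fin 6) :=
  SimpleGraph.fromEdgeSet {s(0, 1), s(0, 2), s(1, 2), s(0, 3), s(1, 4), s(2, 5)}

section InducedDensity

/-- The probability that a uniformly random mapping `Fin k → V(G)` pulls `G` back to `H`. -/
noncomputable def patternDensity {k : ℕ} (H : SimpleGraph (Fin k)) (G : FiniteGraph) : ℝ :=
  (Nat.card {f : Fin k → Fin G.order // G.graph.comap f = H} : ℝ) / (G.order : ℝ) ^ k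

open Classical in
theorem homDensity_eq_sum {k : ℕ} (H : SimpleGraph (Fin k)) (G : FiniteGraph) :
    homDensity ⟨k, H⟩ G = ∑ H' ∈ Finset.univ.filter (fun H' => H ≤ H'), patternDensity H' G := by
  have h1 : Nat.card (H →g G.graph) =
      (Finset.univ.filter (fun f : Fin k → Fin G.order => H ≤ G.graph.comap f)).card := by
    rw [← Fintype.card_subtype, ← Nat.card_eq_fintype_card]
    refine Nat.card_congr ⟨fun f => ⟨f, fun a b h => f.map_rel h⟩,
      fun f => ⟨f.1, fun {a b} h => f.2 h⟩, fun f => rfl, fun f => rfl⟩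
  have h2 : (Finset.univ.filter (fun f : Fin k → Fin G.order => H ≤ G.graph.comap f)).card =
      ∑ H' ∈ Finset.univ.filter (fun H' => H ≤ H'),
        Nat.card {f : Fin k → Fin G.order // G.graph.comap f = H'} := by
    rw [Finset.card_eq_sum_card_fiberwise (f := fun f => G.graph.comap f)
      (t := Finset.univ.filter (fun H' => H ≤ H'))]
    · refine Finset.sum_congr rfl fun H' hH' => ?_
      rw [Nat.card_eq_fintype_card, Fintype.card_subtype, Finset.filter_filter]
      congr 1
      ext f
      simp only [Finset.mem_filter, Finset.mem_univ, true_and] at hH' ⊢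
      exact ⟨fun h => h.2, fun h => ⟨h ▸ hH', h⟩⟩
    · intro f hf
      simpa using hf
  unfold homDensity patternDensity
  simp only [h1, h2]
  push_cast
  rw [Finset.sum_div]

theorem exists_tendsto_patternDensity (Γ : GraphLimit) {k : ℕ} (H : SimpleGraph (Fin k)) :
    ∃ c : ℝ, ∀ G : ℕ → FiniteGraph, ConvergesTo G Γ →
      Tendsto (fun n => patternDensity H (G n)) atTop (𝓝 c) := by
  classical
  induction H using WellFoundedGT.induction with
  | ind H ih =>
    choose! c hc using ih
    refine ⟨Γ.t ⟨k, H⟩ - ∑ H' ∈ (Finset.univ.filter (fun H' => H ≤ H')).erase H, c H',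
      fun G hG => ?_⟩
    have h1 : ∀ n, patternDensity H (G n) = homDensity ⟨k, H⟩ (G n) -
        ∑ H' ∈ (Finset.univ.filter (fun H' => H ≤ H')).erase H, patternDensity H' (G n) := by
      intro n
      rw [homDensity_eq_sum, ← Finset.add_sum_erase _ _
        (show H ∈ Finset.univ.filter (fun H' => H ≤ H') by simp)]
      ring
    simp only [h1]
    refine (hG.2 _).sub (tendsto_finsetSum _ fun H' hH' => hc H' ?_ G hG)
    simp only [Finset.mem_erase, Finset.mem_filter, Finset.mem_univ, true_and] at hH'
    exact lt_of_le_of_ne hH'.2 (Ne.symm hH'.1)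

theorem card_injective_eq {W : Type*} [Fintype W] (F : SimpleGraph W) (G : FiniteGraph) :
    Nat.card {f : Fin (Fintype.card W) → Fin G.order //
      Function.Injective f ∧ Nonempty (G.graph.comap f ≃g F)} =
    Nat.card {S : Finset (Fin G.order) // S.card = Fintype.card W ∧
      Nonempty (G.graph.induce (S : Set (Fin G.order)) ≃g F)} * (Fintype.card W).factorial := by
  classical
  set k := Fintype.card W
  let A := {S : Finset (Fin G.order) // S.card = k ∧
      Nonempty (G.graph.induce (S : Set (Fin G.order)) ≃g F)}
  have iso : ∀ (S : Finset (Fin G.order)) (e : Fin k ≃ (S : Set (Fin G.order))),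
      Nonempty (G.graph.comap (fun i => (e i : Fin G.order)) ≃g
        G.graph.induce (S : Set (Fin G.order))) := fun S e => ⟨⟨e, by simp⟩⟩
  let φ : (Σ S : A, Fin k ≃ (S.1 : Set (Fin G.order))) → {f : Fin k → Fin G.order //
      Function.Injective f ∧ Nonempty (G.graph.comap f ≃g F)} := fun p =>
    ⟨fun i => (p.2 i : Fin G.order), fun i j h => p.2.injective (Subtype.ext h),
      ⟨(iso p.1.1 p.2).some.trans p.1.2.2.some⟩⟩
  have hφ : Function.Bijective φ := by
    constructor
    · rintro ⟨⟨S, hS⟩, e⟩ ⟨⟨T, hT⟩, e'⟩ h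
      have h' : ∀ i, (e i : Fin G.order) = e' i := fun i => congrFun (congrArg Subtype.val h) i
      have hST : S = T := by
        ext v
        constructor
        · intro hv
          have := h' (e.symm ⟨v, hv⟩)
          rw [Equiv.apply_symm_apply] at this
          have h2 : v = _ := this
          rw [h2]
          exact (e' _).2
        · intro hv
          have := h' (e'.symm ⟨v, hv⟩)
          rw [Equiv.apply_symm_apply] at this
          have h2 : _ = v := this
          rw [← h2]
          exact (e _).2
      subst hST
      congr 1
      ext i
      exact congrArg _ (h' i)
    · rintro ⟨f, hf, ⟨g⟩⟩
      let S : Finset (Fin G.order) := Finset.univ.image f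
      have hmem : ∀ i, f i ∈ (S : Set (Fin G.order)) := fun i => by simp [S]
      let e : Fin k ≃ (S : Set (Fin G.order)) := Equiv.ofBijective (fun i => ⟨f i, hmem i⟩)
        ⟨fun i j h => hf (congrArg Subtype.val h), fun ⟨v, hv⟩ => by
          obtain ⟨i, -, hi⟩ := Finset.mem_image.1 (Finset.mem_coe.1 hv)
          exact ⟨i, Subtype.ext hi⟩⟩
      have hS : S.card = k := by
        rw [Finset.card_image_of_injective _ hf]; simp
      exact ⟨⟨⟨S, hS, ⟨(iso S e).some.symm.trans g⟩⟩, e⟩, rfl⟩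
  rw [← Nat.card_congr (Equiv.ofBijective φ hφ), Nat.card_sigma]
  have : ∀ S : A, Nat.card (Fin k ≃ (S.1 : Set (Fin G.order))) = k.factorial := by
    intro S
    have e : Fin k ≃ (S.1 : Set (Fin G.order)) := (Fintype.equivFinOfCardEq (by
      simpa using S.2.1)).symm
    rw [Nat.card_eq_fintype_card, Fintype.card_equiv e, Fintype.card_fin]
  rw [Finset.sum_congr rfl fun S _ => this S]
  simp [A]

/-- If `G n → Γ`, then `t_ind(F, G n)` converges, and its limit depends on `F` and `Γ` only. -/
theorem exists_tendsto_indDensity {W : Type*} [Fintype W] (F : SimpleGraph W) (Γ : GraphLimit) :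
    ∃ c : ℝ, ∀ G : ℕ → FiniteGraph, ConvergesTo G Γ →
      Tendsto (fun n => indDensity F (G n)) atTop (𝓝 c) := by
  classical
  set k := Fintype.card W with hk
  choose c hc using fun H : SimpleGraph (Fin k) => exists_tendsto_patternDensity Γ H
  refine ⟨∑ H ∈ Finset.univ.filter (fun H : SimpleGraph (Fin k) => Nonempty (H ≃g F)), c H,
    fun G hG => ?_⟩
  have hsum : Tendsto (fun n => ∑ H ∈ Finset.univ.filter
      (fun H : SimpleGraph (Fin k) => Nonempty (H ≃g F)), patternDensity H (G n)) atTop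
      (𝓝 (∑ H ∈ Finset.univ.filter
        (fun H : SimpleGraph (Fin k) => Nonempty (H ≃g F)), c H)) :=
    tendsto_finsetSum _ fun H _ => hc H G hG
  have hratio : Tendsto (fun N : ℕ => (N.descFactorial k : ℝ) / (N : ℝ) ^ k) atTop (𝓝 1) := by
    refine (Asymptotics.isEquivalent_iff_tendsto_one ?_).1 (isEquivalent_descFactorial k)
    filter_upwards [eventually_gt_atTop 0] with N hN
    positivity
  have hratio' := hratio.comp hG.1
  have key : ∀ N : FiniteGraph, k ≤ N.order → 0 < N.order →
      |indDensity F N * ((N.order.descFactorial k : ℝ) / (N.order : ℝ) ^ k) -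
        ∑ H ∈ Finset.univ.filter
          (fun H : SimpleGraph (Fin k) => Nonempty (H ≃g F)), patternDensity H N| ≤
        1 - (N.order.descFactorial k : ℝ) / (N.order : ℝ) ^ k := by
    intro N hN hN0
    have hchoose : (0 : ℝ) < (N.order.choose k : ℝ) := by exact_mod_cast Nat.choose_pos hN
    have hpow : (0 : ℝ) < (N.order : ℝ) ^ k := by positivity
    -- all maps whose pullback is isomorphic to `F`
    let B := Finset.univ.filter
      (fun f : Fin k → Fin N.order => Nonempty (N.graph.comap f ≃g F))
    let I := Finset.univ.filter (fun f : Fin k → Fin N.order => Function.Injective f)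
    have hsumB : ∑ H ∈ Finset.univ.filter
          (fun H : SimpleGraph (Fin k) => Nonempty (H ≃g F)), patternDensity H N =
        (B.card : ℝ) / (N.order : ℝ) ^ k := by
      unfold patternDensity
      rw [← Finset.sum_div]
      congr 1
      rw [← Nat.cast_sum, Finset.card_eq_sum_card_fiberwise (f := fun f => N.graph.comap f)
        (t := Finset.univ.filter (fun H : SimpleGraph (Fin k) => Nonempty (H ≃g F)))]
      · congr 1
        refine Finset.sum_congr rfl fun H hH => ?_
        rw [Nat.card_eq_fintype_card, Fintype.card_subtype]
        congr 1
        ext f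
        simp only [B, Finset.mem_filter, Finset.mem_univ, true_and] at hH ⊢
        exact ⟨fun h => ⟨h ▸ hH, h⟩, fun h => h.2⟩
      · intro f hf
        simpa [B] using hf
    have hind : indDensity F N * ((N.order.descFactorial k : ℝ) / (N.order : ℝ) ^ k) =
        ((B ∩ I).card : ℝ) / (N.order : ℝ) ^ k := by
      have h1 := card_injective_eq F N
      rw [Nat.card_eq_fintype_card, Fintype.card_subtype] at h1
      have h2 : (B ∩ I) = Finset.univ.filter (fun f : Fin k → Fin N.order =>
          Function.Injective f ∧ Nonempty (N.graph.comap f ≃g F)) := by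
        ext f; simp [B, I, and_comm]
      rw [h2, h1, Nat.descFactorial_eq_factorial_mul_choose]
      unfold indDensity
      rw [← hk]
      push_cast
      field_simp
    have hI : I.card = N.order.descFactorial k := by
      rw [← Fintype.card_subtype, Fintype.card_congr
        (Equiv.subtypeInjectiveEquivEmbedding (Fin k) (Fin N.order)), Fintype.card_embedding_eq]
      simp
    have hU : (Finset.univ : Finset (Fin k → Fin N.order)).card = N.order ^ k := by simp
    have hle : (B.card : ℝ) ≤ ((B ∩ I).card : ℝ) + ((N.order : ℝ) ^ k - N.order.descFactorial k) := by
      have h1 := Finset.card_union_add_card_inter B I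
      have h2 := Finset.card_le_univ (B ∪ I)
      rw [← Finset.card_univ, hU] at h2
      rw [hI] at h1
      have h3 : (B.card : ℝ) + N.order.descFactorial k = (B ∪ I).card + (B ∩ I).card := by
        exact_mod_cast h1.symm
      have h4 : ((B ∪ I).card : ℝ) ≤ (N.order : ℝ) ^ k := by exact_mod_cast h2
      linarith
    have hge : ((B ∩ I).card : ℝ) ≤ B.card := by
      exact_mod_cast Finset.card_le_card Finset.inter_subset_left
    rw [hsumB, hind, ← sub_div, abs_div, abs_of_pos hpow, div_le_iff₀ hpow, sub_mul,
      div_mul_cancel₀ _ hpow.ne', one_mul, abs_sub_comm, abs_of_nonneg (by linarith)]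
    linarith
  have hev : ∀ᶠ n in atTop, k ≤ (G n).order ∧ 0 < (G n).order :=
    (hG.1.eventually_ge_atTop k).and (hG.1.eventually_gt_atTop 0)
  have hdiff : Tendsto (fun n => indDensity F (G n) *
      (((G n).order.descFactorial k : ℝ) / ((G n).order : ℝ) ^ k) -
        ∑ H ∈ Finset.univ.filter
          (fun H : SimpleGraph (Fin k) => Nonempty (H ≃g F)), patternDensity H (G n))
      atTop (𝓝 0) := by
    refine squeeze_zero_norm' (a := fun n => 1 - ((G n).order.descFactorial k : ℝ) /
      ((G n).order : ℝ) ^ k) ?_ ?_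
    · filter_upwards [hev] with n hn
      exact key (G n) hn.1 hn.2
    · simpa using hratio'.const_sub 1
  have hfin := (hdiff.add hsum).div hratio' one_ne_zero
  rw [zero_add, div_one] at hfin
  refine hfin.congr' ?_
  filter_upwards [hev] with n hn
  have h1 : (0 : ℝ) < ((G n).order.descFactorial k : ℝ) := by
    exact_mod_cast Nat.pos_of_ne_zero fun h => absurd (Nat.descFactorial_eq_zero_iff_lt.1 h)
      (not_lt.2 hn.1)
  have h2 : (0 : ℝ) < ((G n).order : ℝ) ^ k := pow_pos (by exact_mod_cast hn.2) _
  simp only [Pi.div_apply, Function.comp_apply, sub_add_cancel]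
  field_simp

end InducedDensity

/-- `t_ind(F, Γ)`: the common limit of `t_ind(F, G n)` over all sequences `G n → Γ`. It exists by
`exists_tendsto_indDensity`, and it is unique since every `Γ` is the limit of some sequence. -/
noncomputable def tInd {W : Type*} [Fintype W] (F : SimpleGraph W) (Γ : GraphLimit) : ℝ :=
  (exists_tendsto_indDensity F Γ).choose

theorem tendsto_indDensity {W : Type*} [Fintype W] (F : SimpleGraph W) (Γ : GraphLimit)
    (G : ℕ → FiniteGraph) (hG : ConvergesTo G Γ) :
    Tendsto (fun n => indDensity F (G n)) atTop (𝓝 (tInd F Γ)) :=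
  (exists_tendsto_indDensity F Γ).choose_spec G hG

end IntervalLimits

/-! Unit interval graphs are closed under induced subgraphs, and no forbidden graph is one. None
embeds in the members of a sequence of unit interval graphs, so all forbidden densities vanish in
the limit.

The converse combines a finite characterization with sampling. A finite graph without the forbidden
induced subgraphs is a unit interval graph (`IsForbiddenFree.isUnitIntervalGraph`). To see this,
find in each component an end vertex `z`, to be placed leftmost (`exists_isEndVertex`). The distance
layers around `z` are then cliques (`adj_of_dist_eq`), and inside a layer the neighbourhoods in the
next layer grow as those in the previous one shrink (`subset_of_layerRank_le`). Sorting by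
component, layer and rank gives an order in which every vertex between two adjacent ones is adjacent
to both; such an order is realized by reals chosen greedily (`isUnitIntervalGraph_of_order`).

If the forbidden densities of `Γ` are zero and `G n → Γ`, a random sample of fixed size `N` from `G
n` contains a forbidden graph with probability tending to zero, by a union bound
(`mapProb_embedding_le`). A second moment estimate uniform in `G n` keeps its homomorphism densities
close to those of `G n` (`mapMean_sq_homDensity_sub_le`). Some sample is therefore a unit interval
graph close to `Γ`, and these samples converge to `Γ`. -/

namespace IntervalLimits

/-! ### Unit interval graphs: obstructions and realization of a vertex order. -/

section UnitInterval

variable {V : Type*} {G : SimpleGraph V}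

theorem isUnitIntervalGraph_iff :
    IsUnitIntervalGraph G ↔ ∃ x : V → ℝ, ∀ v w, v ≠ w → (G.Adj v w ↔ |x v - x w| ≤ 1) := by
  have h (a b : ℝ) : (Set.Icc a (a + 1) ∩ Set.Icc b (b + 1)).Nonempty ↔ |a - b| ≤ 1 := by
    rw [Set.Icc_inter_Icc, Set.nonempty_Icc, abs_le]
    simp only [sup_le_iff, le_inf_iff]
    constructor
    · rintro ⟨⟨h1, h2⟩, h3, h4⟩
      constructor <;> linarith
    · rintro ⟨h1, h2⟩
      refine ⟨⟨?_, ?_⟩, ?_, ?_⟩ <;> linarith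
  simp only [IsUnitIntervalGraph, h]

theorem IsUnitIntervalGraph.of_embedding {W : Type*} {F : SimpleGraph W}
    (hG : IsUnitIntervalGraph G) (e : F ↪g G) : IsUnitIntervalGraph F := by
  obtain ⟨x, hx⟩ := hG
  refine ⟨x ∘ e, fun v w hvw => ?_⟩
  rw [← e.map_adj_iff]
  exact hx _ _ (e.injective.ne hvw)

/-- Real numbers at distance more than one cannot be pairwise linked through common points at
distance at most one. -/
theorem false_of_pairwise_linked {a b c p q r : ℝ} (hab : 1 < |a - b|) (hac : 1 < |a - c|)
    (hbc : 1 < |b - c|) (hap : |a - p| ≤ 1) (hbp : |b - p| ≤ 1) (haq : |a - q| ≤ 1)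
    (hcq : |c - q| ≤ 1) (hbr : |b - r| ≤ 1) (hcr : |c - r| ≤ 1) : False := by
  -- The outer two of `a`, `b`, `c` are more than two apart, so no point is within one of both.
  rw [abs_le] at hap hbp haq hcq hbr hcr
  rw [lt_abs] at hab hac hbc
  rcases hab with h1 | h1 <;> rcases hac with h2 | h2 <;> rcases hbc with h3 | h3 <;> linarith

theorem not_isUnitIntervalGraph_claw :
    ¬ IsUnitIntervalGraph (completeBipartiteGraph (Fin 1) (Fin 3)) := by
  rw [isUnitIntervalGraph_iff]
  rintro ⟨x, hx⟩
  have hn (i j : Fin 3) (hij : i ≠ j) : 1 < |x (Sum.inr i) - x (Sum.inr j)| := by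
    rw [← not_le, ← hx _ _ (by simpa using hij)]; simp
  have ha (i : Fin 3) : |x (Sum.inr i) - x (Sum.inl 0)| ≤ 1 := by
    rw [← hx _ _ (by simp)]; simp
  exact false_of_pairwise_linked (hn 0 1 (by decide)) (hn 0 2 (by decide)) (hn 1 2 (by decide))
    (ha 0) (ha 1) (ha 0) (ha 2) (ha 1) (ha 2)

instance : DecidableRel graphS3.Adj := fun a b => by
  unfold graphS3; rw [SimpleGraph.fromEdgeSet_adj]
  simp only [Set.mem_insert_iff, Set.mem_singleton_iff]; infer_instance

/-- In the complement the vertices `0, 1, 2` are independent, and each two of them have a common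
neighbour among `3, 4, 5`. -/
theorem not_isUnitIntervalGraph_graphS3_compl : ¬ IsUnitIntervalGraph graphS3ᶜ := by
  rw [isUnitIntervalGraph_iff]
  rintro ⟨x, hx⟩
  have hn (i j : Fin 6) (hij : i ≠ j) (h : ¬ graphS3ᶜ.Adj i j) : 1 < |x i - x j| := by
    rwa [← not_le, ← hx _ _ hij]
  have ha (i j : Fin 6) (h : graphS3ᶜ.Adj i j) : |x i - x j| ≤ 1 := (hx _ _ h.ne).1 h
  exact false_of_pairwise_linked (hn 0 1 (by decide) (by decide)) (hn 0 2 (by decide) (by decide))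
    (hn 1 2 (by decide) (by decide)) (ha 0 5 (by decide)) (ha 1 5 (by decide))
    (ha 0 4 (by decide)) (ha 2 4 (by decide)) (ha 1 3 (by decide)) (ha 2 3 (by decide))

/-- A point within one of the middle triangle vertex is within one of an outer triangle vertex, so
the middle one cannot have a private neighbour. The case split covers all relative positions. -/
theorem not_isUnitIntervalGraph_graphS3 : ¬ IsUnitIntervalGraph graphS3 := by
  rw [isUnitIntervalGraph_iff]
  rintro ⟨x, hx⟩
  have hn (i j : Fin 6) (hij : i ≠ j) (h : ¬ graphS3.Adj i j) : 1 < |x i - x j| := by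
    rwa [← not_le, ← hx _ _ hij]
  have ha (i j : Fin 6) (h : graphS3.Adj i j) : |x i - x j| ≤ 1 := (hx _ _ h.ne).1 h
  have h01 := abs_le.1 (ha 0 1 (by decide))
  have h02 := abs_le.1 (ha 0 2 (by decide))
  have h12 := abs_le.1 (ha 1 2 (by decide))
  have h03 := abs_le.1 (ha 0 3 (by decide))
  have h14 := abs_le.1 (ha 1 4 (by decide))
  have h25 := abs_le.1 (ha 2 5 (by decide))
  have n04 := lt_abs.1 (hn 0 4 (by decide) (by decide))
  have n05 := lt_abs.1 (hn 0 5 (by decide) (by decide))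
  have n13 := lt_abs.1 (hn 1 3 (by decide) (by decide))
  have n15 := lt_abs.1 (hn 1 5 (by decide) (by decide))
  have n23 := lt_abs.1 (hn 2 3 (by decide) (by decide))
  have n24 := lt_abs.1 (hn 2 4 (by decide) (by decide))
  rcases n04 with h | h <;> rcases n05 with h' | h' <;> rcases n13 with k | k <;>
    rcases n15 with k' | k' <;> rcases n23 with l | l <;> rcases n24 with l' | l' <;> linarith

/-- Both neighbours of the leftmost vertex lie within one to its right, so they would be adjacent to
each other. -/
theorem not_isUnitIntervalGraph_cycleGraph {k : ℕ} (hk : 4 ≤ k) :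
    ¬ IsUnitIntervalGraph (SimpleGraph.cycleGraph k) := by
  rw [isUnitIntervalGraph_iff]
  rintro ⟨x, hx⟩
  obtain ⟨n, rfl⟩ : ∃ n, k = n + 2 := ⟨k - 2, by omega⟩
  obtain ⟨i, hi⟩ := Finite.exists_min x
  have e1 : (SimpleGraph.cycleGraph (n + 2)).Adj (i + 1) i := by
    simp [SimpleGraph.cycleGraph_adj]
  have e2 : (SimpleGraph.cycleGraph (n + 2)).Adj (i - 1) i := by
    simp [SimpleGraph.cycleGraph_adj]
  have v1 : (1 : Fin (n + 2)).val = 1 := by simp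
  have v2 : (1 + 1 : Fin (n + 2)).val = 2 := by
    rw [Fin.val_add, v1, Nat.mod_eq_of_lt (by omega)]
  have v3 : (1 + 1 + 1 : Fin (n + 2)).val = 3 := by
    rw [Fin.val_add, v1, v2, Nat.mod_eq_of_lt (by omega)]
  have hsub : (i + 1) - (i - 1) = 1 + 1 := by abel
  have hne : i + 1 ≠ i - 1 := by
    intro h
    rw [h, sub_self] at hsub
    rw [← hsub] at v2; simp at v2
  have e3 : ¬ (SimpleGraph.cycleGraph (n + 2)).Adj (i + 1) (i - 1) := by
    rw [SimpleGraph.cycleGraph_adj]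
    rintro (h | h)
    · rw [hsub] at h
      rw [h, v1] at v2; omega
    · have h' : (1 + 1 + 1 : Fin (n + 2)) = 0 := by
        have : (1 + 1 + 1 : Fin (n + 2)) = 1 - ((i - 1) - (i + 1)) := by abel
        rw [this, h, sub_self]
      rw [h'] at v3; simp at v3
  rw [hx _ _ e1.ne, abs_le] at e1
  rw [hx _ _ e2.ne, abs_le] at e2
  rw [hx _ _ hne, abs_le] at e3
  have := hi (i + 1)
  have := hi (i - 1)
  exact e3 ⟨by linarith, by linarith⟩

/-- A finite graph whose vertices can be ordered so that the vertices between two adjacent ones are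
adjacent to both of them is a unit interval graph. -/
theorem isUnitIntervalGraph_of_order [Finite V] {α : Type*} [LinearOrder α] (key : V → α)
    (hkey : Function.Injective key)
    (h : ∀ u v w, key u < key v → key v < key w → G.Adj u w → G.Adj u v ∧ G.Adj v w) :
    IsUnitIntervalGraph G := by
  classical
  have := Fintype.ofFinite V
  -- Points are placed from left to right. Keeping all inequalities strict leaves room for the next
  -- point.
  have main : ∀ s : Finset V, ∃ x : V → ℝ, ∀ u ∈ s, ∀ v ∈ s, key u < key v → x u < x v ∧
      (G.Adj u v → x v < x u + 1) ∧ (¬ G.Adj u v → x u + 1 < x v) := by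
    intro s
    induction s using Finset.induction_on_max_value key with
    | empty => simp
    | insert a s has hmax ih =>
      obtain ⟨x, hx⟩ := ih
      have hlt : ∀ u ∈ s, key u < key a := fun u hu =>
        lt_of_le_of_ne (hmax u hu) (hkey.ne (by rintro rfl; exact has hu))
      obtain ⟨y, hyl, hyu⟩ : ∃ y : ℝ, (∀ u ∈ s, x u < y ∧ (¬ G.Adj u a → x u + 1 < y)) ∧
          ∀ u ∈ s, G.Adj u a → y < x u + 1 := by
        -- Each lower bound for the new point is below each upper bound; the hypothesis on the order
        -- enters when `w` precedes `u`.
        have hLU : ∀ u ∈ s, ∀ w ∈ s, G.Adj w a → x u < x w + 1 ∧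
            (¬ G.Adj u a → x u + 1 < x w + 1) := by
          intro u hu w hw hwa
          rcases lt_trichotomy (key u) (key w) with huw | huw | huw
          · have := (hx u hu w hw huw).1
            exact ⟨by linarith, fun _ => by linarith⟩
          · obtain rfl := hkey huw
            exact ⟨by linarith, fun h => absurd hwa h⟩
          · have := h w u a huw (hlt u hu) hwa
            exact ⟨(hx w hw u hu huw).2.1 this.1, fun h => absurd this.2 h⟩
        let L : Finset ℝ := s.image x ∪ (s.filter fun u => ¬ G.Adj u a).image fun u => x u + 1
        let U : Finset ℝ := (s.filter fun u => G.Adj u a).image fun u => x u + 1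
        obtain ⟨y, hy1, hy2⟩ : ∃ y, (∀ l ∈ L, l < y) ∧ ∀ r ∈ U, y < r := by
          refine Order.exists_between_finsets L U ?_
          intro l hl r hr
          simp only [L, U, Finset.mem_union, Finset.mem_image, Finset.mem_filter] at hl hr
          obtain ⟨w, ⟨hw, hwa⟩, rfl⟩ := hr
          rcases hl with ⟨u, hu, rfl⟩ | ⟨u, ⟨hu, hua⟩, rfl⟩
          · exact (hLU u hu w hw hwa).1
          · exact (hLU u hu w hw hwa).2 hua
        refine ⟨y, fun u hu => ⟨hy1 _ ?_, fun hua => hy1 _ ?_⟩, fun u hu hua => hy2 _ ?_⟩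
        · exact Finset.mem_union_left _ (Finset.mem_image_of_mem _ hu)
        · exact Finset.mem_union_right _
            (Finset.mem_image_of_mem (fun u => x u + 1) (Finset.mem_filter.2 ⟨hu, hua⟩))
        · exact Finset.mem_image_of_mem (fun u => x u + 1) (Finset.mem_filter.2 ⟨hu, hua⟩)
      refine ⟨Function.update x a y, fun u hu v hv huv => ?_⟩
      rcases Finset.mem_insert.1 hu with rfl | hus
      · rcases Finset.mem_insert.1 hv with rfl | hvs
        · exact absurd huv (lt_irrefl _)
        · exact absurd huv (hlt v hvs).asymm
      · have hua : u ≠ a := by rintro rfl; exact has hus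
        rcases Finset.mem_insert.1 hv with rfl | hvs
        · simp only [Function.update_self, Function.update_of_ne hua]
          exact ⟨(hyl u hus).1, hyu u hus, (hyl u hus).2⟩
        · have hva : v ≠ a := by rintro rfl; exact has hvs
          simp only [Function.update_of_ne hua, Function.update_of_ne hva]
          exact hx u hus v hvs huv
  obtain ⟨x, hx⟩ := main Finset.univ
  have key_lt : ∀ u v, key u < key v → (G.Adj u v ↔ |x u - x v| ≤ 1) := by
    intro u v huv
    obtain ⟨h1, h2, h3⟩ := hx u (Finset.mem_univ _) v (Finset.mem_univ _) huv
    rw [abs_le]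
    constructor
    · intro h
      have := h2 h
      constructor <;> linarith
    · rintro ⟨h4, -⟩
      by_contra h
      have := h3 h
      linarith
  refine isUnitIntervalGraph_iff.2 ⟨x, fun u v huv => ?_⟩
  rcases lt_or_gt_of_ne (hkey.ne huv) with h | h
  · exact key_lt u v h
  · rw [G.adj_comm, abs_sub_comm]
    exact key_lt v u h

end UnitInterval

/-! ### Forbidden induced subgraphs and common neighbours. -/

section ForbiddenSubgraphs

variable {V : Type*} {G : SimpleGraph V}

/-- `G` has no induced cycle of length at least four, no claw, no `S₃` and no complement of `S₃`. -/
structure IsForbiddenFree (G : SimpleGraph V) : Prop where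
  cycle : ∀ k, 4 ≤ k → IsEmpty (SimpleGraph.cycleGraph k ↪g G)
  claw : IsEmpty (completeBipartiteGraph (Fin 1) (Fin 3) ↪g G)
  net : IsEmpty (graphS3 ↪g G)
  sun : IsEmpty (graphS3ᶜ ↪g G)

theorem nonempty_embedding_of_lt {n : ℕ} {F : SimpleGraph (Fin n)} (f : Fin n → V)
    (hf : Function.Injective f) (h : ∀ i j, i < j → (G.Adj (f i) (f j) ↔ F.Adj i j)) :
    Nonempty (F ↪g G) := by
  refine ⟨⟨⟨f, hf⟩, fun {i j} => ?_⟩⟩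
  change G.Adj (f i) (f j) ↔ F.Adj i j
  rcases lt_trichotomy i j with hij | rfl | hij
  · exact h i j hij
  · simp
  · rw [G.adj_comm, F.adj_comm]; exact h j i hij

/-- When no two vertices of `F` have the same neighbours, preserving adjacency and non-adjacency
already forces injectivity. This applies to the net and the sun; the claw and the square have twins,
so distinctness is assumed for those. -/
theorem injective_of_adj_iff {n : ℕ} {F : SimpleGraph (Fin n)} (f : Fin n → V)
    (hF : ∀ i j, (∀ l, F.Adj i l ↔ F.Adj j l) → i = j)
    (h : ∀ i j, i < j → (G.Adj (f i) (f j) ↔ F.Adj i j)) : Function.Injective f := by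
  have h' : ∀ i j, G.Adj (f i) (f j) ↔ F.Adj i j := by
    intro i j
    rcases lt_trichotomy i j with hij | rfl | hij
    · exact h i j hij
    · simp
    · rw [G.adj_comm, F.adj_comm]; exact h j i hij
  intro i j hij
  refine hF i j fun l => ?_
  rw [← h', ← h', hij]

namespace IsForbiddenFree

theorem false_of_claw (hG : IsForbiddenFree G) {c x y w : V} (hx : G.Adj c x) (hy : G.Adj c y)
    (hw : G.Adj c w) (hxy : ¬ G.Adj x y) (hxw : ¬ G.Adj x w) (hyw : ¬ G.Adj y w)
    (nxy : x ≠ y) (nxw : x ≠ w) (nyw : y ≠ w) : False := by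
  have hinj : Function.Injective ![x, y, w] := by
    intro i j
    fin_cases i <;> fin_cases j <;> simp [nxy, nxw, nyw, nxy.symm, nxw.symm, nyw.symm]
  have hc : ∀ i, G.Adj c (![x, y, w] i) := by
    intro i; fin_cases i <;> assumption
  have hn : ∀ i j, ¬ G.Adj (![x, y, w] i) (![x, y, w] j) := by
    have hyx := fun h : G.Adj y x => hxy h.symm
    have hwx := fun h : G.Adj w x => hxw h.symm
    have hwy := fun h : G.Adj w y => hyw h.symm
    intro i j; fin_cases i <;> fin_cases j <;> first | assumption | exact G.loopless.irrefl _
  refine hG.claw.false ⟨⟨Sum.elim (fun _ => c) ![x, y, w], ?_⟩, ?_⟩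
  · rintro (i | i) (j | j) h
    · rw [Subsingleton.elim i j]
    · exact absurd h (hc j).ne
    · exact absurd h (hc i).ne'
    · exact congrArg _ (hinj h)
  · rintro (i | i) (j | j)
    · exact iff_of_false (G.loopless.irrefl c) (by simp)
    · exact iff_of_true (hc j) (by simp)
    · exact iff_of_true (hc i).symm (by simp)
    · exact iff_of_false (hn i j) (by simp)

theorem false_of_square (hG : IsForbiddenFree G) {x y w t : V} (hxy : G.Adj x y) (hyw : G.Adj y w)
    (hwt : G.Adj w t) (hxt : G.Adj x t) (hxw : ¬ G.Adj x w) (hyt : ¬ G.Adj y t)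
    (nxw : x ≠ w) (nyt : y ≠ t) : False := by
  have e1 := hxy.ne
  have e2 := hyw.ne
  have e3 := hwt.ne
  have e4 := hxt.ne
  have hinj : Function.Injective ![x, y, w, t] := by
    intro i j
    fin_cases i <;> fin_cases j <;>
      simp [nxw, nyt, nxw.symm, nyt.symm, e1, e2, e3, e4, e1.symm, e2.symm, e3.symm, e4.symm]
  obtain ⟨e⟩ := nonempty_embedding_of_lt (G := G) (F := SimpleGraph.cycleGraph 4) _ hinj (by
    intro i j hij
    fin_cases i <;> fin_cases j <;>
      first
      | exact absurd hij (by decide)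
      | exact iff_of_true (by assumption) (by decide)
      | exact iff_of_false (by assumption) (by decide))
  exact (hG.cycle 4 le_rfl).false e

theorem false_of_net (hG : IsForbiddenFree G) {a b c a' b' c' : V} (hab : G.Adj a b)
    (hac : G.Adj a c) (hbc : G.Adj b c) (ha : G.Adj a a') (hb : G.Adj b b') (hc : G.Adj c c')
    (n1 : ¬ G.Adj a b') (n2 : ¬ G.Adj a c') (n3 : ¬ G.Adj b a') (n4 : ¬ G.Adj b c')
    (n5 : ¬ G.Adj c a') (n6 : ¬ G.Adj c b') (n7 : ¬ G.Adj a' b') (n8 : ¬ G.Adj a' c')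
    (n9 : ¬ G.Adj b' c') : False := by
  have h : ∀ i j, i < j → (G.Adj (![a, b, c, a', b', c'] i) (![a, b, c, a', b', c'] j) ↔
      graphS3.Adj i j) := by
    intro i j hij
    fin_cases i <;> fin_cases j <;>
      first
      | exact absurd hij (by decide)
      | exact iff_of_true (by assumption) (by decide)
      | exact iff_of_false (by assumption) (by decide)
  obtain ⟨e⟩ := nonempty_embedding_of_lt _ (injective_of_adj_iff _ (by decide) h) h
  exact hG.net.false e

theorem false_of_sun (hG : IsForbiddenFree G) {a b c a' b' c' : V} (hab : G.Adj a b)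
    (hac : G.Adj a c) (hbc : G.Adj b c) (h1 : G.Adj a' b) (h2 : G.Adj a' c) (h3 : G.Adj b' a)
    (h4 : G.Adj b' c) (h5 : G.Adj c' a) (h6 : G.Adj c' b) (n1 : ¬ G.Adj a' a)
    (n2 : ¬ G.Adj b' b) (n3 : ¬ G.Adj c' c) (n4 : ¬ G.Adj a' b') (n5 : ¬ G.Adj a' c')
    (n6 : ¬ G.Adj b' c') : False := by
  have h : ∀ i j, i < j → (G.Adj (![a', b', c', a, b, c] i) (![a', b', c', a, b, c] j) ↔
      graphS3ᶜ.Adj i j) := by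
    intro i j hij
    fin_cases i <;> fin_cases j <;>
      first
      | exact absurd hij (by decide)
      | exact iff_of_true (by assumption) (by decide)
      | exact iff_of_false (by assumption) (by decide)
  obtain ⟨e⟩ := nonempty_embedding_of_lt _ (injective_of_adj_iff _ (by decide) h) h
  exact hG.sun.false e

end IsForbiddenFree

/-- The graph on `V` whose edges are the edges of `G` inside `C`. -/
def within (G : SimpleGraph V) (C : Set V) : SimpleGraph V where
  Adj a b := G.Adj a b ∧ a ∈ C ∧ b ∈ C
  symm := ⟨fun _ _ h => ⟨h.1.symm, h.2.2, h.2.1⟩⟩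
  loopless := ⟨fun _ h => h.1.ne rfl⟩

/-- Any two vertices of `C` are joined by a path in `G` inside `C`. -/
def ConnectedOn (G : SimpleGraph V) (C : Set V) : Prop :=
  ∀ u ∈ C, ∀ v ∈ C, (within G C).Reachable u v

theorem within_mono {C D : Set V} (h : C ⊆ D) : within G C ≤ within G D :=
  fun _ _ h' => ⟨h'.1, h h'.2.1, h h'.2.2⟩

theorem ConnectedOn.insert_of_adj {C : Set V} (hC : ConnectedOn G C) {s c : V} (hc : c ∈ C)
    (hs : G.Adj s c) : ConnectedOn G (insert s C) := by
  have key : ∀ u ∈ insert s C, (within G (insert s C)).Reachable c u := by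
    rintro u (rfl | hu)
    · exact SimpleGraph.Adj.reachable ⟨hs.symm, Set.mem_insert_of_mem _ hc, Set.mem_insert _ _⟩
    · exact (hC c hc u hu).mono (within_mono (Set.subset_insert _ _))
  exact fun u hu v hv => (key u hu).symm.trans (key v hv)

/-- A shortcut between two vertices of a shortest walk would shorten the whole walk. -/
theorem dist_getVert {H : SimpleGraph V} {p q : V} (W : H.Walk p q) (hW : W.length = H.dist p q)
    {i j : ℕ} (hij : i ≤ j) (hj : j ≤ W.length) :
    H.dist (W.getVert i) (W.getVert j) = j - i := by
  have h1 : H.dist p (W.getVert i) ≤ i :=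
    ((SimpleGraph.dist_le (W.take i)).trans_eq (W.take_length i)).trans (min_le_left _ _)
  have h2 : H.dist (W.getVert j) q ≤ W.length - j :=
    (SimpleGraph.dist_le (W.drop j)).trans_eq (W.drop_length j)
  have h3 : H.dist (W.getVert i) (W.getVert j) ≤ j - i := by
    have hv : (W.drop i).getVert (j - i) = W.getVert j := by
      rw [SimpleGraph.Walk.drop_getVert]; congr 1; omega
    have := ((SimpleGraph.dist_le ((W.drop i).take (j - i))).trans_eq
      (SimpleGraph.Walk.take_length _ _)).trans (min_le_left _ _)
    rwa [hv] at this
  have r1 : H.Reachable p (W.getVert i) := ⟨W.take i⟩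
  have r2 : H.Reachable (W.getVert j) q := ⟨W.drop j⟩
  have t1 := r1.dist_triangle_left q
  have t2 := r2.dist_triangle_right (W.getVert i)
  omega

/-- In a graph without induced cycles of length at least four, the ends of an edge that both see a
connected set have a common neighbour in it. -/
theorem IsForbiddenFree.exists_common_neighbor (hG : IsForbiddenFree G) {C : Set V} {p q u v : V}
    (hpq : G.Adj p q) (hC : ConnectedOn G C) (hp : p ∉ C) (hq : q ∉ C) (hu : u ∈ C) (hv : v ∈ C)
    (hpu : G.Adj p u) (hqv : G.Adj q v) : ∃ w ∈ C, G.Adj p w ∧ G.Adj q w := by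
  -- `H` is `G` on `C ∪ {p, q}` without the edge `pq`. A shortest walk from `p` to `q` in `H`,
  -- closed by `pq`, is an induced cycle, so its length must be two.
  let H : SimpleGraph V :=
    { Adj := fun a b => (within G (insert p (insert q C))).Adj a b ∧
        ¬ (a = p ∧ b = q) ∧ ¬ (a = q ∧ b = p)
      symm := ⟨fun _ _ h => ⟨h.1.symm, fun h' => h.2.2 h'.symm, fun h' => h.2.1 h'.symm⟩⟩
      loopless := ⟨fun _ h => h.1.ne rfl⟩ }
  have hH : ∀ a b, H.Adj a b → G.Adj a b := fun a b h => h.1.1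
  have hHC : within G C ≤ H := by
    refine fun a b h => ⟨within_mono (fun x hx => by simp [hx]) h, ?_, ?_⟩
    · rintro ⟨rfl, -⟩; exact hp h.2.1
    · rintro ⟨rfl, -⟩; exact hq h.2.1
  have hup : u ≠ p := by rintro rfl; exact hp hu
  have huq : u ≠ q := by rintro rfl; exact hq hu
  have hvp : v ≠ p := by rintro rfl; exact hp hv
  have hvq : v ≠ q := by rintro rfl; exact hq hv
  have hpu' : H.Adj p u := ⟨⟨hpu, by simp, by simp [hu]⟩, by simp [huq], by simp [hup]⟩
  have hvq' : H.Adj v q := ⟨⟨hqv.symm, by simp [hv], by simp⟩, by simp [hvp], by simp [hvq]⟩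
  have hreach : H.Reachable p q :=
    hpu'.reachable.trans (((hC u hu v hv).mono hHC).trans hvq'.reachable)
  obtain ⟨W, hW⟩ := hreach.exists_walk_length_eq_dist
  have hd := fun {i j : ℕ} (hij : i ≤ j) (hj : j ≤ W.length) => dist_getVert W hW hij hj
  have h0 : W.length ≠ 0 := fun h => hpq.ne (SimpleGraph.Walk.eq_of_length_eq_zero h)
  have h1 : W.length ≠ 1 := fun h => by
    have := SimpleGraph.Walk.adj_of_length_eq_one h
    exact this.2.1 ⟨rfl, rfl⟩
  by_cases h2 : W.length = 2
  · have a1 : H.Adj p (W.getVert 1) := by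
      simpa using W.adj_getVert_succ (i := 0) (by omega)
    have a2 : H.Adj (W.getVert 1) q := by
      have := W.adj_getVert_succ (i := 1) (by omega)
      rwa [W.getVert_of_length_le (i := 1 + 1) (by omega)] at this
    refine ⟨W.getVert 1, ?_, hH _ _ a1, (hH _ _ a2).symm⟩
    rcases a1.1.2.2 with h | h | h
    · exact absurd h a1.ne'
    · exact absurd h a2.ne
    · exact h
  · exfalso
    have hinj : ∀ i j, i < j → j ≤ W.length → W.getVert i ≠ W.getVert j := by
      intro i j hij hj h
      have := hd hij.le hj
      rw [h, SimpleGraph.dist_self] at this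
      omega
    -- A chord other than `pq` would be an edge of `H`, so its ends have distance one and are
    -- consecutive on the walk.
    have hadj : ∀ i j, i < j → j ≤ W.length →
        (G.Adj (W.getVert i) (W.getVert j) ↔ j = i + 1 ∨ (i = 0 ∧ j = W.length)) := by
      intro i j hij hj
      constructor
      · intro h
        by_cases hex : i = 0 ∧ j = W.length
        · exact Or.inr hex
        · left
          have hT : ∀ i, i ≤ W.length → W.getVert i ∈ insert p (insert q C) := by
            intro i hi
            rcases Nat.eq_zero_or_pos i with rfl | hi0
            · simp
            · have := W.adj_getVert_succ (i := i - 1) (by omega)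
              rw [Nat.sub_add_cancel hi0] at this
              exact this.1.2.2
          have hqi : ∀ i, i < W.length → W.getVert i ≠ q := by
            intro i hi h
            refine hinj i W.length hi le_rfl ?_
            rw [h, W.getVert_length]
          have hpj : ∀ i, 0 < i → i ≤ W.length → W.getVert i ≠ p := by
            intro i hi0 hi h
            refine hinj 0 i hi0 hi ?_
            rw [h, W.getVert_zero]
          have : H.Adj (W.getVert i) (W.getVert j) := by
            refine ⟨⟨h, hT i (by omega), hT j hj⟩, ?_, ?_⟩
            · rintro ⟨e1, e2⟩
              refine hex ⟨?_, ?_⟩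
              · by_contra hi
                exact hpj i (by omega) (by omega) e1
              · by_contra hj'
                exact hqi j (by omega) e2
            · rintro ⟨e1, -⟩
              exact hqi i (by omega) e1
          rw [← SimpleGraph.dist_eq_one_iff_adj, hd hij.le hj] at this
          omega
      · rintro (rfl | ⟨rfl, rfl⟩)
        · exact hH _ _ (W.adj_getVert_succ (by omega))
        · simpa using hpq
    obtain ⟨e⟩ := nonempty_embedding_of_lt (G := G)
      (F := SimpleGraph.cycleGraph (W.length + 1)) (fun i => W.getVert i) (by
        intro i j h
        rcases lt_trichotomy i j with hij | hij | hij
        · exact absurd h (hinj i j hij (by omega))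
        · exact hij
        · exact absurd h.symm (hinj j i hij (by omega))) (by
        intro i j hij
        rw [hadj i j hij (by omega), SimpleGraph.cycleGraph_adj', Fin.sub_val_of_le hij.le]
        have hlt : (i : ℕ) < j := hij
        rw [Fin.coe_sub_iff_lt.2 hij]
        omega)
    exact (hG.cycle (W.length + 1) (by omega)).false e

end ForbiddenSubgraphs

/-! ### End vertices, distance layers and the finite characterization. -/

section EndVertices

variable {V : Type*} {G : SimpleGraph V}

/-- A vertex whose neighbours form a clique, with the neighbours nested by what they see at
distance two. -/
structure IsEndVertex (G : SimpleGraph V) (z : V) : Prop where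
  simplicial : ∀ p q, G.Adj z p → G.Adj z q → p ≠ q → G.Adj p q
  nested : ∀ p q u v, G.Adj z p → G.Adj z q → G.Adj p u → G.Adj q v → ¬ G.Adj z u → u ≠ z →
    ¬ G.Adj z v → v ≠ z → ¬ G.Adj p v → ¬ G.Adj q u → False

/-- In a complete component any vertex works. Otherwise take a largest connected set `C` that
misses, together with its neighbours, some vertex `z` of the component. Maximality makes `z`
extremal: outside `C`, the vertices that see `C` and those that do not form one clique. -/
theorem IsForbiddenFree.exists_isEndVertex [Finite V] (hG : IsForbiddenFree G) (a : V) :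
    ∃ z, G.Reachable a z ∧ IsEndVertex G z := by
  by_cases hcomplete : ∀ u v, G.Reachable a u → G.Reachable a v → u ≠ v → G.Adj u v
  · refine ⟨a, .rfl, fun p q hp hq => hcomplete p q hp.reachable hq.reachable, ?_⟩
    intro p q u v hp _ hpu _ hu hu' _ _ _ _
    exact hu (hcomplete a u .rfl (hp.reachable.trans hpu.reachable) hu'.symm)
  push Not at hcomplete
  obtain ⟨b, b', hb, hb', hbb', hnb⟩ := hcomplete
  let 𝒞 : Set (Set V) := {C | C.Nonempty ∧ (∀ c ∈ C, G.Reachable a c) ∧ ConnectedOn G C ∧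
    ∃ z, z ∉ C ∧ G.Reachable a z ∧ ∀ c ∈ C, ¬ G.Adj z c}
  obtain ⟨C, ⟨⟨c₀, hc₀⟩, hCa, hCc, z, hzC, hza, hz⟩, hmax⟩ :=
    Set.exists_max_image 𝒞 Set.ncard 𝒞.toFinite ⟨{b}, Set.singleton_nonempty b, by simpa using hb,
      by rintro _ rfl _ rfl; exact .rfl, b', by simpa using hbb'.symm, hb', by
      rintro _ rfl h; exact hnb h.symm⟩
  -- If `s` sees `C` but not `r`, then `insert s C` with witness `r` contradicts maximality.
  have complete_join : ∀ s, s ∉ C → (∃ c ∈ C, G.Adj s c) → ∀ r, r ∉ C → G.Reachable a r →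
      (∀ c ∈ C, ¬ G.Adj r c) → G.Adj r s := by
    rintro s hs ⟨c, hc, hsc⟩ r hrC hra hr
    by_contra hrs
    have hmem : insert s C ∈ 𝒞 := by
      refine ⟨⟨s, Set.mem_insert _ _⟩, ?_, hCc.insert_of_adj hc hsc, r, ?_, hra, ?_⟩
      · rintro x (rfl | hx)
        · exact (hCa c hc).trans hsc.symm.reachable
        · exact hCa x hx
      · rintro (rfl | h)
        · exact hr c hc hsc
        · exact hrC h
      · rintro x (rfl | hx)
        · exact hrs
        · exact hr x hx
    have := hmax _ hmem
    rw [Set.ncard_insert_of_notMem hs] at this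
    omega
  obtain ⟨s₀, hs₀, c₁, hc₁, hs₀c⟩ : ∃ s, s ∉ C ∧ ∃ c ∈ C, G.Adj s c := by
    obtain ⟨W⟩ := (hCa c₀ hc₀).symm.trans hza
    obtain ⟨d, -, h1, h2⟩ := W.exists_boundary_dart C hc₀ hzC
    exact ⟨d.snd, h2, d.fst, h1, d.adj.symm⟩
  have clique_far : ∀ r r', r ∉ C → G.Reachable a r → (∀ c ∈ C, ¬ G.Adj r c) → r' ∉ C →
      G.Reachable a r' → (∀ c ∈ C, ¬ G.Adj r' c) → r ≠ r' → G.Adj r r' := by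
    intro r r' hrC hra hr hrC' hra' hr' hne
    by_contra hn
    have h1 := complete_join s₀ hs₀ ⟨c₁, hc₁, hs₀c⟩ r hrC hra hr
    have h2 := complete_join s₀ hs₀ ⟨c₁, hc₁, hs₀c⟩ r' hrC' hra' hr'
    exact hG.false_of_claw h1.symm h2.symm hs₀c hn (hr _ hc₁) (hr' _ hc₁) hne
      (by rintro rfl; exact hrC hc₁) (by rintro rfl; exact hrC' hc₁)
  -- The ends of the edge between `z` and `s'` have a common neighbour in `insert s C`. As `z` sees
  -- nothing in `C`, it is `s`.
  have clique_near : ∀ s s', s ∉ C → (∃ c ∈ C, G.Adj s c) → s' ∉ C → (∃ c ∈ C, G.Adj s' c) →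
      s ≠ s' → G.Adj s s' := by
    rintro s s' hs ⟨c, hc, hsc⟩ hs' ⟨c', hc', hsc'⟩ hne
    have h1 := complete_join s hs ⟨c, hc, hsc⟩ z hzC hza hz
    have h2 := complete_join s' hs' ⟨c', hc', hsc'⟩ z hzC hza hz
    obtain ⟨w, hw, hzw, hsw⟩ := hG.exists_common_neighbor h2 (hCc.insert_of_adj hc hsc)
      (by rintro (rfl | h); exacts [h1.ne rfl, hzC h])
      (by rintro (rfl | h); exacts [hne rfl, hs' h]) (Set.mem_insert _ _)
      (Set.mem_insert_of_mem _ hc') h1 hsc'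
    rcases hw with rfl | hw
    · exact hsw.symm
    · exact absurd hzw (hz w hw)
  have hznC : ∀ p, G.Adj z p → p ∉ C := fun p hp h => hz p h hp
  refine ⟨z, hza, ?_, ?_⟩
  · intro p q hp hq hpq
    have hpa := hza.trans hp.reachable
    have hqa := hza.trans hq.reachable
    by_cases h1 : ∃ c ∈ C, G.Adj p c <;> by_cases h2 : ∃ c ∈ C, G.Adj q c
    · exact clique_near p q (hznC p hp) h1 (hznC q hq) h2 hpq
    · exact (complete_join p (hznC p hp) h1 q (hznC q hq) hqa
        (fun c hc h => h2 ⟨c, hc, h⟩)).symm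
    · exact complete_join q (hznC q hq) h2 p (hznC p hp) hpa (fun c hc h => h1 ⟨c, hc, h⟩)
    · exact clique_far p q (hznC p hp) hpa (fun c hc h => h1 ⟨c, hc, h⟩) (hznC q hq) hqa
        (fun c hc h => h2 ⟨c, hc, h⟩) hpq
  · intro p q u v hp hq hpu hqv hzu nzu hzv nzv hpv hqu
    -- In its component, `z` is adjacent to every other vertex outside `C`, so a vertex at distance
    -- two lies in `C`.
    have memC : ∀ p u, G.Adj z p → G.Adj p u → ¬ G.Adj z u → u ≠ z → u ∈ C := by
      intro p u hp hpu hzu nzu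
      by_contra hu
      have hua := (hza.trans hp.reachable).trans hpu.reachable
      by_cases h : ∃ c ∈ C, G.Adj u c
      · exact hzu (complete_join u hu h z hzC hza hz)
      · exact hzu (clique_far z u hzC hza hz hu hua (fun c hc h' => h ⟨c, hc, h'⟩) nzu.symm)
    have huC := memC p u hp hpu hzu nzu
    have hvC := memC q v hq hqv hzv nzv
    have npq : p ≠ q := by rintro rfl; exact hqu hpu
    have hpq := clique_near p q (hznC p hp) ⟨u, huC, hpu⟩ (hznC q hq) ⟨v, hvC, hqv⟩ npq
    have nuq : u ≠ q := by rintro rfl; exact hzu hq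
    have npv : p ≠ v := by rintro rfl; exact hzv hp
    have huv : ¬ G.Adj u v := fun huv =>
      hG.false_of_square hpu huv hqv.symm hpq hpv (fun h => hqu h.symm) npv nuq
    -- Absence of claws at `p` and `q` joins `w` to `u` and `v`; the triangle `p, q, w` with `u, v,
    -- z` is then a sun.
    obtain ⟨w, hw, hpw, hqw⟩ := hG.exists_common_neighbor hpq hCc (hznC p hp) (hznC q hq) huC hvC
      hpu hqv
    have nzw : z ≠ w := by rintro rfl; exact hzC hw
    have huw : G.Adj u w := by
      by_contra h
      exact hG.false_of_claw hp.symm hpu hpw hzu (hz w hw) h nzu.symm nzw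
        (by rintro rfl; exact hqu hqw)
    have hvw : G.Adj v w := by
      by_contra h
      exact hG.false_of_claw hq.symm hqv hqw hzv (hz w hw) h nzv.symm nzw
        (by rintro rfl; exact hpv hpw)
    exact hG.false_of_sun (a := p) (b := q) (c := w) (a' := v) (b' := u) (c' := z) hpq hpw hqw
      hqv.symm hvw hpu.symm huw hp hq (fun h => hpv h.symm) (fun h => hqu h.symm) (hz w hw)
      (fun h => huv h.symm) (fun h => hzv h.symm) (fun h => hzu h.symm)

theorem exists_pred_of_dist_eq_succ {z u : V} {i : ℕ} (h : G.dist z u = i + 1) :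
    ∃ p, G.Reachable z p ∧ G.dist z p = i ∧ G.Adj p u := by
  -- Unreachable vertices have `dist` equal to `0`, so a positive distance provides a walk.
  obtain ⟨W, hW⟩ := SimpleGraph.exists_walk_of_dist_ne_zero (G := G) (u := z) (v := u) (by omega)
  have hd := dist_getVert W hW (i := 0) (j := i) (by omega) (by omega)
  rw [W.getVert_zero] at hd
  have ha := W.adj_getVert_succ (i := i) (by omega)
  rw [W.getVert_of_length_le (i := i + 1) (by omega)] at ha
  exact ⟨W.getVert i, ⟨W.take i⟩, by omega, ha⟩

theorem not_adj_of_dist {z u v : V} (h : G.dist z u + 2 ≤ G.dist z v) : ¬ G.Adj u v := by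
  intro hadj
  rcases hadj.diff_dist_adj (u := z) with h | h | h <;> omega

/-- Induction on the layer. Non-adjacent `u`, `v` cannot share a predecessor (claw), so they have
distinct predecessors `p`, `q`, adjacent by induction. In the first layer this contradicts
nestedness at `z`. Further out, a common predecessor of `p` and `q` gives a net, and distinct ones
give a square. -/
theorem IsForbiddenFree.adj_of_dist_eq (hG : IsForbiddenFree G) {z : V} (hz : IsEndVertex G z) :
    ∀ (i : ℕ) (u v : V), G.Reachable z u → G.Reachable z v → G.dist z u = i → G.dist z v = i →
      u ≠ v → G.Adj u v := by
  intro i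
  induction i using Nat.strong_induction_on with
  | _ i ih =>
    intro u v hzu hzv hu hv huv
    match i, ih, hu, hv with
    | 0, _, hu, hv =>
      rw [hzu.dist_eq_zero_iff] at hu
      rw [hzv.dist_eq_zero_iff] at hv
      exact absurd (hu.symm.trans hv) huv
    | 1, _, hu, hv =>
      exact hz.simplicial u v (SimpleGraph.dist_eq_one_iff_adj.1 hu)
        (SimpleGraph.dist_eq_one_iff_adj.1 hv) huv
    | i + 2, ih, hu, hv =>
      by_contra hn
      obtain ⟨p, hzp, hp, hpu⟩ := exists_pred_of_dist_eq_succ hu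
      obtain ⟨q, hzq, hq, hqv⟩ := exists_pred_of_dist_eq_succ hv
      have claw : ∀ p u v, G.dist z p = i + 1 → G.dist z u = i + 2 → G.dist z v = i + 2 → u ≠ v →
          ¬ G.Adj u v → G.Adj p u → ¬ G.Adj p v := by
        intro p u v hp hu hv huv hn hpu hpv
        obtain ⟨p', -, hp', hpp'⟩ := exists_pred_of_dist_eq_succ hp
        exact hG.false_of_claw hpp'.symm hpu hpv (not_adj_of_dist (z := z) (by omega))
          (not_adj_of_dist (z := z) (by omega)) hn (by rintro rfl; omega) (by rintro rfl; omega) huv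
      have hpv := claw p u v hp hu hv huv hn hpu
      have hqu := claw q v u hq hv hu huv.symm (fun h => hn h.symm) hqv
      have npq : p ≠ q := by rintro rfl; exact hpv hqv
      have hpq := ih (i + 1) (by omega) p q hzp hzq hp hq npq
      rcases i with _ | i
      · have hzz : G.dist z z = 0 := SimpleGraph.dist_self
        exact hz.nested p q u v (SimpleGraph.dist_eq_one_iff_adj.1 hp)
          (SimpleGraph.dist_eq_one_iff_adj.1 hq) hpu hqv (not_adj_of_dist (z := z) (by omega))
          (by rintro rfl; omega) (not_adj_of_dist (z := z) (by omega)) (by rintro rfl; omega)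
          hpv hqu
      · have net : ∀ r, G.dist z r = i + 1 → G.Adj r p → G.Adj r q → False := by
          intro r hr hrp hrq
          obtain ⟨r', -, hr', hrr'⟩ := exists_pred_of_dist_eq_succ hr
          have hr'p : ¬ G.Adj r' p := not_adj_of_dist (z := z) (by omega)
          have hr'q : ¬ G.Adj r' q := not_adj_of_dist (z := z) (by omega)
          exact hG.false_of_net hrp hrq hpq hrr'.symm hpu hqv (not_adj_of_dist (z := z) (by omega))
            (not_adj_of_dist (z := z) (by omega)) (fun h => hr'p h.symm) hpv
            (fun h => hr'q h.symm) hqu (not_adj_of_dist (z := z) (by omega))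
            (not_adj_of_dist (z := z) (by omega)) hn
        obtain ⟨p', hzp', hp', hpp'⟩ := exists_pred_of_dist_eq_succ hp
        obtain ⟨q', hzq', hq', hqq'⟩ := exists_pred_of_dist_eq_succ hq
        have hp'q : ¬ G.Adj p' q := fun h => net p' hp' hpp' h
        have hq'p : ¬ G.Adj q' p := fun h => net q' hq' h hqq'
        have np'q' : p' ≠ q' := by rintro rfl; exact hp'q hqq'
        have hp'q' := ih (i + 1) (by omega) p' q' hzp' hzq' hp' hq' np'q'
        exact hG.false_of_square hpp' hpq hqq'.symm hp'q' hp'q (fun h => hq'p h.symm)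
          (by rintro rfl; omega) (by rintro rfl; omega)

/-- The neighbours of `u` that are one step further away from `z`. -/
def outNeighbors (G : SimpleGraph V) (z u : V) : Set V :=
  {w | G.Adj u w ∧ G.dist z w = G.dist z u + 1}

/-- The neighbours of `u` that are one step closer to `z`. -/
def inNeighbors (G : SimpleGraph V) (z u : V) : Set V :=
  {w | G.Adj u w ∧ G.dist z w + 1 = G.dist z u}

/-- The rank that orders the vertices at a given distance from `z`. -/
noncomputable def layerRank (G : SimpleGraph V) (z u : V) : ℤ :=
  (outNeighbors G z u).ncard - (inNeighbors G z u).ncard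

/-- Out-neighbourhoods in a layer are comparable, and so are in-neighbourhoods: two private
neighbours in one layer are adjacent and would close a square. A vertex with both a private
out-neighbour and a private in-neighbour against `v` would centre a claw with `v`. So the two
inclusions run in opposite directions, and the difference of the cardinalities detects them. -/
theorem IsForbiddenFree.subset_of_layerRank_le [Finite V] (hG : IsForbiddenFree G) {z u v : V}
    (hz : IsEndVertex G z) (hzu : G.Reachable z u) (hzv : G.Reachable z v)
    (hd : G.dist z u = G.dist z v) (hr : layerRank G z u ≤ layerRank G z v) :
    outNeighbors G z u ⊆ outNeighbors G z v ∧ inNeighbors G z v ⊆ inNeighbors G z u := by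
  rcases eq_or_ne u v with rfl | huv
  · exact ⟨subset_rfl, subset_rfl⟩
  have hadj := hG.adj_of_dist_eq hz _ u v hzu hzv rfl hd.symm huv
  have nested : ∀ x y, G.Adj u x → G.Adj v y → G.dist z x = G.dist z y →
      G.dist z x ≠ G.dist z u → ¬ G.Adj u y → ¬ G.Adj v x → False := by
    intro x y hux hvy hxy hxu huy hvx
    have nxy : x ≠ y := by rintro rfl; exact huy hux
    have hxy' := hG.adj_of_dist_eq hz _ x y (hzu.trans hux.reachable) (hzv.trans hvy.reachable)
      rfl hxy.symm nxy
    exact hG.false_of_square hux hxy' hvy.symm hadj huy (fun h => hvx h.symm)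
      (by rintro rfl; exact hxu hxy) (by rintro rfl; exact hxu hd.symm)
  have cross : ∀ u v, G.Adj u v → G.dist z u = G.dist z v → ∀ x y, x ∈ outNeighbors G z u →
      x ∉ outNeighbors G z v → y ∈ inNeighbors G z u → y ∉ inNeighbors G z v → False := by
    rintro u v huv hd x y ⟨hux, hx⟩ hxv ⟨huy, hy⟩ hyv
    have hvx : ¬ G.Adj v x := fun h => hxv ⟨h, by omega⟩
    have hvy : ¬ G.Adj v y := fun h => hyv ⟨h, by omega⟩
    have hyx : ¬ G.Adj y x := not_adj_of_dist (z := z) (by omega)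
    exact hG.false_of_claw huv hux huy hvx hvy (fun h => hyx h.symm) (by rintro rfl; omega)
      (by rintro rfl; omega) (by rintro rfl; omega)
  have hfin := fun s : Set V => s.toFinite
  unfold layerRank at hr
  constructor
  · intro x hxu
    by_contra hxv
    have h1 : outNeighbors G z v ⊂ outNeighbors G z u := by
      refine ⟨fun y hy => ?_, fun h => hxv (h hxu)⟩
      by_contra hyu
      obtain ⟨a1, d1⟩ := hxu
      obtain ⟨a2, d2⟩ := hy
      exact nested x y a1 a2 (by omega) (by omega) (fun h => hyu ⟨h, by omega⟩)
        (fun h => hxv ⟨h, by omega⟩)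
    have h2 : inNeighbors G z u ⊆ inNeighbors G z v := by
      intro y hy
      by_contra hyv
      exact cross u v hadj hd x y hxu hxv hy hyv
    have := Set.ncard_lt_ncard h1 (hfin _)
    have := Set.ncard_le_ncard h2 (hfin _)
    omega
  · intro y hyv
    by_contra hyu
    have h1 : inNeighbors G z u ⊂ inNeighbors G z v := by
      refine ⟨fun x hx => ?_, fun h => hyu (h hyv)⟩
      by_contra hxv
      obtain ⟨a1, d1⟩ := hx
      obtain ⟨a2, d2⟩ := hyv
      exact nested x y a1 a2 (by omega) (by omega) (fun h => hyu ⟨h, by omega⟩)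
        (fun h => hxv ⟨h, by omega⟩)
    have h2 : outNeighbors G z v ⊆ outNeighbors G z u := by
      intro x hx
      by_contra hxu
      exact cross v u hadj.symm hd.symm x y hx hxu hyv hyu
    have := Set.ncard_lt_ncard h1 (hfin _)
    have := Set.ncard_le_ncard h2 (hfin _)
    omega

/-- A finite graph without induced cycles of length at least four, claws, nets and suns is a unit
interval graph. -/
theorem IsForbiddenFree.isUnitIntervalGraph [Finite V] (hG : IsForbiddenFree G) :
    IsUnitIntervalGraph G := by
  obtain ⟨n, ⟨idx⟩⟩ := Finite.exists_equiv_fin V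
  choose zc hzc using fun c : G.ConnectedComponent =>
    (hG.exists_isEndVertex c.nonempty_supp.some)
  let z : V → V := fun v => zc (G.connectedComponentMk v)
  have hzr : ∀ v, G.Reachable (z v) v := by
    intro v
    have h1 := (hzc (G.connectedComponentMk v)).1
    have h2 : G.connectedComponentMk (G.connectedComponentMk v).nonempty_supp.some =
      G.connectedComponentMk v := (G.connectedComponentMk v).nonempty_supp.some_mem
    exact h1.symm.trans (SimpleGraph.ConnectedComponent.eq.1 h2)
  have hze : ∀ v, IsEndVertex G (z v) := fun v => (hzc _).2
  -- Sort by component (through its end vertex), then by layer, then by rank; `idx v` only breaks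
  -- ties.
  let key : V → Fin n ×ₗ ℕ ×ₗ ℤ ×ₗ Fin n := fun v => toLex (idx (z v), toLex (G.dist (z v) v,
    toLex (layerRank G (z v) v, idx v)))
  have key_lt : ∀ u v, key u < key v → idx (z u) ≤ idx (z v) ∧ (z u = z v →
      G.dist (z u) u ≤ G.dist (z v) v ∧ (G.dist (z u) u = G.dist (z v) v →
        layerRank G (z u) u ≤ layerRank G (z v) v)) := by
    intro u v h
    simp only [key, Prod.Lex.toLex_lt_toLex] at h
    rcases h with h | ⟨h, h'⟩
    · exact ⟨h.le, fun e => absurd (congrArg idx e) h.ne⟩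
    · refine ⟨h.le, fun _ => ?_⟩
      rcases h' with h' | ⟨h', h''⟩
      · exact ⟨h'.le, fun e => absurd e h'.ne⟩
      · refine ⟨h'.le, fun _ => ?_⟩
        rcases h'' with h'' | h''
        exacts [h''.le, h''.1.le]
  refine isUnitIntervalGraph_of_order key ?_ ?_
  · intro u v h
    simp only [key, toLex_inj, Prod.mk.injEq] at h
    exact idx.injective h.2.2.2
  · intro u v w huv hvw huw
    have e1 : z u = z w := by
      simp only [z]; rw [SimpleGraph.ConnectedComponent.eq.2 huw.reachable]
    have k1 := key_lt u v huv
    have k2 := key_lt v w hvw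
    have nuv : u ≠ v := by rintro rfl; exact lt_irrefl _ huv
    have nvw : v ≠ w := by rintro rfl; exact lt_irrefl _ hvw
    have e2 : z u = z v := idx.injective (le_antisymm k1.1 (by rw [e1]; exact k2.1))
    have e3 : z v = z w := e2.symm.trans e1
    obtain ⟨d1, r1⟩ := k1.2 e2
    obtain ⟨d2, r2⟩ := k2.2 e3
    have hu := hzr u
    have hv := hzr v
    have hw := hzr w
    have hz := hze w
    rw [e1] at d1 r1 hu
    rw [e3] at d1 r1 d2 r2 hv
    have hadj := hG.adj_of_dist_eq hz
    -- Adjacent `u`, `w` are at most one layer apart, so `v` shares a layer with `u` or `w`. In the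
    -- mixed cases the inclusions transfer the edge `uw` to `v`.
    by_cases huv' : G.dist (z w) u = G.dist (z w) v <;>
      by_cases hvw' : G.dist (z w) v = G.dist (z w) w
    · exact ⟨hadj _ u v hu hv huv' rfl nuv, hadj _ v w hv hw hvw' rfl nvw⟩
    · have hdw : G.dist (z w) w = G.dist (z w) u + 1 := by
        rcases huw.diff_dist_adj (u := z w) with h | h | h <;> omega
      exact ⟨hadj _ u v hu hv huv' rfl nuv,
        ((hG.subset_of_layerRank_le hz hu hv huv' (r1 huv')).1 ⟨huw, hdw⟩).1⟩
    · have hdw : G.dist (z w) u + 1 = G.dist (z w) w := by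
        rcases huw.diff_dist_adj (u := z w) with h | h | h <;> omega
      exact ⟨((hG.subset_of_layerRank_le hz hv hw hvw' (r2 hvw')).2 ⟨huw.symm, hdw⟩).1.symm,
        hadj _ v w hv hw hvw' rfl nvw⟩
    · exfalso
      rcases huw.diff_dist_adj (u := z w) with h | h | h <;> omega

end EndVertices

/-! ### Expectation and probability for uniformly random maps. -/

section RandomMaps

variable {ι κ : Type*} [Fintype ι] [Fintype κ] {M : ℕ}

open Classical in
/-- The expectation of `g` at a uniformly random map `κ → Fin M`. -/
noncomputable def mapMean (g : (κ → Fin M) → ℝ) : ℝ :=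
  (∑ φ, g φ) / (M : ℝ) ^ Fintype.card κ

open Classical in
/-- The probability of `P` at a uniformly random map `κ → Fin M`. -/
noncomputable def mapProb (P : (κ → Fin M) → Prop) : ℝ :=
  mapMean fun φ => if P φ then 1 else 0

theorem mapMean_mono {g h : (κ → Fin M) → ℝ} (hgh : ∀ φ, g φ ≤ h φ) : mapMean g ≤ mapMean h := by
  unfold mapMean
  gcongr with φ
  exact hgh φ

theorem mapMean_const (hM : 0 < M) (c : ℝ) : mapMean (fun _ : κ → Fin M => c) = c := by
  have : (M : ℝ) ≠ 0 := by positivity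
  simp [mapMean, this]

theorem mapMean_sub (g h : (κ → Fin M) → ℝ) :
    mapMean (fun φ => g φ - h φ) = mapMean g - mapMean h := by
  simp [mapMean, Finset.sum_sub_distrib, sub_div]

theorem mapMean_sum {α : Type*} (s : Finset α) (g : α → (κ → Fin M) → ℝ) :
    mapMean (fun φ => ∑ i ∈ s, g i φ) = ∑ i ∈ s, mapMean (g i) := by
  simp only [mapMean]
  rw [Finset.sum_comm, Finset.sum_div]

theorem mapMean_mul_left (c : ℝ) (g : (κ → Fin M) → ℝ) :
    mapMean (fun φ => c * g φ) = c * mapMean g := by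
  simp only [mapMean]
  rw [← Finset.mul_sum, mul_div_assoc]

theorem mapMean_mul_right (c : ℝ) (g : (κ → Fin M) → ℝ) :
    mapMean (fun φ => g φ * c) = mapMean g * c := by
  simp only [mul_comm _ c, mapMean_mul_left]

theorem mapMean_comm {N : ℕ} (g : (κ → Fin M) → (ι → Fin N) → ℝ) :
    mapMean (fun φ => mapMean (g φ)) = mapMean fun f => mapMean fun φ => g φ f := by
  simp only [mapMean]
  rw [← Finset.sum_div, ← Finset.sum_div, Finset.sum_comm, div_right_comm]

theorem mapMean_sumElim (g : (ι ⊕ κ → Fin M) → ℝ) :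
    mapMean g = mapMean fun a : ι → Fin M => mapMean fun b : κ → Fin M => g (Sum.elim a b) := by
  classical
  simp only [mapMean]
  rw [← Finset.sum_div, div_div, Fintype.card_sum, pow_add, mul_comm ((M : ℝ) ^ Fintype.card κ),
    ← Fintype.sum_prod_type']
  refine congrArg (· / _) ?_
  refine Finset.sum_equiv (Equiv.sumArrowEquivProdArrow ι κ (Fin M)) (by simp) fun φ _ => ?_
  congr 1
  ext (i | i) <;> rfl

theorem mapMean_comp_equiv (e : ι ≃ κ) (g : (ι → Fin M) → ℝ) :
    mapMean (fun φ : κ → Fin M => g (φ ∘ e)) = mapMean g := by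
  classical
  simp only [mapMean]
  rw [Fintype.card_congr e, ← (Equiv.arrowCongr e.symm (Equiv.refl (Fin M))).sum_comp]
  rfl

/-- The restriction of a uniformly random map along an injection is uniformly random. -/
theorem mapMean_comp_injective (hM : 0 < M) {e : ι → κ} (he : Function.Injective e)
    (g : (ι → Fin M) → ℝ) : mapMean (fun φ : κ → Fin M => g (φ ∘ e)) = mapMean g := by
  classical
  let E : ι ⊕ ((Set.range e)ᶜ : Set κ) ≃ κ :=
    ((Equiv.ofInjective e he).sumCongr (Equiv.refl _)).trans (Equiv.Set.sumCompl (Set.range e))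
  have hE : ∀ i, E (Sum.inl i) = e i := fun i => by simp [E]
  rw [← mapMean_comp_equiv E.symm, mapMean_sumElim]
  have : ∀ (a : ι → Fin M) (b : ((Set.range e)ᶜ : Set κ) → Fin M),
      (Sum.elim a b ∘ E.symm) ∘ e = a := by
    intro a b
    ext i
    simp [← hE]
  simp only [this, mapMean_const hM]

theorem mapProb_mono {P Q : (κ → Fin M) → Prop} (h : ∀ φ, P φ → Q φ) : mapProb P ≤ mapProb Q := by
  refine mapMean_mono fun φ => ?_
  by_cases hP : P φ
  · simp [hP, h φ hP]
  · simp only [hP, if_false]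
    split_ifs <;> norm_num

theorem mapProb_nonneg (P : (κ → Fin M) → Prop) : 0 ≤ mapProb P := by
  unfold mapProb mapMean
  positivity

theorem mapProb_or_le (P Q : (κ → Fin M) → Prop) :
    mapProb (fun φ => P φ ∨ Q φ) ≤ mapProb P + mapProb Q := by
  classical
  unfold mapProb mapMean
  rw [← add_div, ← Finset.sum_add_distrib]
  gcongr with φ
  by_cases hP : P φ <;> by_cases hQ : Q φ <;> simp [hP, hQ]

theorem mapProb_exists_le {α : Type*} [Fintype α] (P : α → (κ → Fin M) → Prop) :
    mapProb (fun φ => ∃ i, P i φ) ≤ ∑ i, mapProb (P i) := by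
  classical
  unfold mapProb
  rw [← mapMean_sum]
  refine mapMean_mono fun φ => ?_
  split_ifs with h
  · obtain ⟨i, hi⟩ := h
    refine le_trans ?_ (Finset.single_le_sum (f := fun i => if P i φ then (1 : ℝ) else 0)
      (fun i _ => by positivity) (Finset.mem_univ i))
    simp [hi]
  · positivity

theorem exists_not_of_mapProb_lt_one (hM : 0 < M) {P : (κ → Fin M) → Prop} (h : mapProb P < 1) :
    ∃ φ, ¬ P φ := by
  by_contra! hP
  have : mapProb P = 1 := by
    simp only [mapProb, hP, if_true, mapMean_const hM]
  exact h.ne this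

theorem mapProb_eq_card (P : (κ → Fin M) → Prop) :
    mapProb P = (Nat.card {φ // P φ} : ℝ) / (M : ℝ) ^ Fintype.card κ := by
  classical
  rw [Nat.card_eq_fintype_card, Fintype.card_subtype]
  simp [mapProb, mapMean, Finset.sum_boole]

theorem mapProb_not_injective (hM : 0 < M) :
    mapProb (fun φ : κ → Fin M => ¬ Function.Injective φ) =
      1 - (M.descFactorial (Fintype.card κ) : ℝ) / (M : ℝ) ^ Fintype.card κ := by
  classical
  have h1 : mapProb (fun φ : κ → Fin M => Function.Injective φ) =
      (M.descFactorial (Fintype.card κ) : ℝ) / (M : ℝ) ^ Fintype.card κ := by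
    rw [mapProb_eq_card, Nat.card_congr (Equiv.subtypeInjectiveEquivEmbedding κ (Fin M)),
      Nat.card_eq_fintype_card, Fintype.card_embedding_eq, Fintype.card_fin]
  rw [← h1, ← mapMean_const (κ := κ) hM 1, mapProb, mapProb, ← mapMean_sub]
  congr 1
  ext φ
  by_cases h : Function.Injective φ <;> simp [h]

theorem tendsto_mapProb_not_injective :
    Tendsto (fun N => mapProb fun φ : κ → Fin N => ¬ Function.Injective φ) atTop (𝓝 0) := by
  have h : Tendsto (fun N : ℕ => (N.descFactorial (Fintype.card κ) : ℝ) /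
      (N : ℝ) ^ Fintype.card κ) atTop (𝓝 1) := by
    refine (Asymptotics.isEquivalent_iff_tendsto_one ?_).1
      (isEquivalent_descFactorial (Fintype.card κ))
    filter_upwards [eventually_gt_atTop 0] with N hN
    positivity
  have h' := h.const_sub 1
  rw [sub_self] at h'
  refine h'.congr' ?_
  filter_upwards [eventually_gt_atTop 0] with N hN
  rw [mapProb_not_injective hN]

/-- Chebyshev's inequality for random maps. -/
theorem mapProb_le_of_sq {g : (κ → Fin M) → ℝ} {ε : ℝ} (hε : 0 < ε) :
    mapProb (fun φ => ε ≤ |g φ|) ≤ mapMean (fun φ => g φ ^ 2) / ε ^ 2 := by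
  rw [le_div_iff₀ (by positivity), mapProb, ← mapMean_mul_right]
  refine mapMean_mono fun φ => ?_
  split_ifs with h
  · rw [one_mul, ← sq_abs (g φ)]
    gcongr
  · rw [zero_mul]
    positivity

end RandomMaps

/-! ### Random induced samples: concentration and absence of forbidden graphs. -/

section Sampling

/-- The graph that a map `φ` into the vertices of `G` induces on its domain. -/
def sampleGraph (G : FiniteGraph) {N : ℕ} (φ : Fin N → Fin G.order) : FiniteGraph :=
  ⟨N, G.graph.comap φ⟩

theorem homDensity_eq_mapProb (F G : FiniteGraph) :
    homDensity F G = mapProb fun f : Fin F.order → Fin G.order => F.graph ≤ G.graph.comap f := by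
  rw [mapProb_eq_card, Fintype.card_fin, homDensity]
  congr 2
  exact Nat.card_congr ⟨fun f => ⟨f, fun a b h => f.map_rel h⟩,
    fun f => ⟨f.1, fun {a b} h => f.2 h⟩, fun f => rfl, fun f => rfl⟩

theorem homDensity_sampleGraph (F G : FiniteGraph) {N : ℕ} (φ : Fin N → Fin G.order) :
    homDensity F (sampleGraph G φ) =
      mapProb fun f : Fin F.order → Fin N => F.graph ≤ G.graph.comap (φ ∘ f) := by
  rw [homDensity_eq_mapProb]
  simp only [sampleGraph, SimpleGraph.comap_comap]

/-- The deviation is an average of centred indicators over maps `f` into the sample, so its square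
is an average over pairs of maps. If a pair is jointly injective, its two indicators are independent
and contribute zero; any other pair contributes at most one. The bound does not depend on `G`. -/
theorem mapMean_sq_homDensity_sub_le (F G : FiniteGraph) {N : ℕ} (hN : 0 < N)
    (hG : 0 < G.order) :
    mapMean (fun φ : Fin N → Fin G.order =>
      (homDensity F (sampleGraph G φ) - homDensity F G) ^ 2) ≤
      mapProb fun s : Fin F.order ⊕ Fin F.order → Fin N => ¬ Function.Injective s := by
  classical
  set t := homDensity F G with ht
  let X : (Fin F.order → Fin G.order) → ℝ :=
    fun f => (if F.graph ≤ G.graph.comap f then 1 else 0) - t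
  have hX0 : mapMean X = 0 := by
    rw [mapMean_sub, mapMean_const hG, sub_eq_zero, ht, homDensity_eq_mapProb, mapProb]
  have ht0 : 0 ≤ t := by rw [ht, homDensity_eq_mapProb]; exact mapProb_nonneg _
  have ht1 : t ≤ 1 := by
    rw [ht, homDensity_eq_mapProb, ← mapMean_const (κ := Fin F.order) hG 1]
    refine mapMean_mono fun φ => ?_
    split_ifs <;> norm_num
  have hX1 : ∀ f, |X f| ≤ 1 := by
    intro f
    simp only [X]
    split_ifs <;> rw [abs_le] <;> constructor <;> linarith
  have hT : ∀ φ : Fin N → Fin G.order, homDensity F (sampleGraph G φ) - t =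
      mapMean fun f : Fin F.order → Fin N => X (φ ∘ f) := by
    intro φ
    rw [mapMean_sub, mapMean_const hN, homDensity_sampleGraph, mapProb]
  have hsq : ∀ φ : Fin N → Fin G.order, (homDensity F (sampleGraph G φ) - t) ^ 2 =
      mapMean fun s : Fin F.order ⊕ Fin F.order → Fin N =>
        X (φ ∘ s ∘ Sum.inl) * X (φ ∘ s ∘ Sum.inr) := by
    intro φ
    rw [mapMean_sumElim, hT, sq]
    simp only [Sum.elim_comp_inl, Sum.elim_comp_inr, mapMean_mul_left, mapMean_mul_right]
  simp only [hsq]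
  rw [mapMean_comm]
  refine mapMean_mono fun s => ?_
  split_ifs with hs
  · rw [← mapMean_const (κ := Fin N) hG 1]
    refine mapMean_mono fun φ => ?_
    refine (le_abs_self _).trans ?_
    rw [abs_mul]
    exact mul_le_one₀ (hX1 _) (abs_nonneg _) (hX1 _)
  · rw [not_not] at hs
    have := mapMean_comp_injective hG hs fun r => X (r ∘ Sum.inl) * X (r ∘ Sum.inr)
    simp only [Function.comp_assoc] at this
    rw [this, mapMean_sumElim]
    simp only [Sum.elim_comp_inl, Sum.elim_comp_inr, mapMean_mul_left, hX0, mul_zero]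
    rw [mapMean_const hG]

/-- Union bound over the places `e` in the sample where `F` may sit; the sample restricted along `e`
is again uniformly random. -/
theorem mapProb_embedding_le {W : Type*} [Fintype W] (F : SimpleGraph W) (G : FiniteGraph)
    (N : ℕ) (hG : Fintype.card W ≤ G.order) (hG0 : 0 < G.order) :
    mapProb (fun φ : Fin N → Fin G.order => Function.Injective φ ∧
      Nonempty (F ↪g (sampleGraph G φ).graph)) ≤
      Fintype.card (Fin (Fintype.card W) ↪ Fin N) * indDensity F G := by
  classical
  let P : (Fin (Fintype.card W) → Fin G.order) → Prop := fun f =>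
    Function.Injective f ∧ Nonempty (G.graph.comap f ≃g F)
  have hP : mapProb P ≤ indDensity F G := by
    rw [mapProb_eq_card, card_injective_eq, indDensity, Fintype.card_fin]
    have hc : (0 : ℝ) < G.order.choose (Fintype.card W) := by exact_mod_cast Nat.choose_pos hG
    have hle : ((Fintype.card W).factorial : ℝ) * G.order.choose (Fintype.card W) ≤
        (G.order : ℝ) ^ Fintype.card W := by
      rw [← Nat.cast_mul, ← Nat.descFactorial_eq_factorial_mul_choose]
      exact_mod_cast Nat.descFactorial_le_pow _ _
    rw [div_le_div_iff₀ (by positivity) hc]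
    push_cast
    rw [mul_assoc]
    gcongr
  have hle : mapProb (fun φ : Fin N → Fin G.order => Function.Injective φ ∧
      Nonempty (F ↪g (sampleGraph G φ).graph)) ≤
      mapProb fun φ : Fin N → Fin G.order => ∃ e : Fin (Fintype.card W) ↪ Fin N, P (φ ∘ e) := by
    refine mapProb_mono ?_
    rintro φ ⟨hφ, ⟨e⟩⟩
    let w := (Fintype.equivFin W).symm
    refine ⟨w.toEmbedding.trans e.toEmbedding, hφ.comp (Function.Embedding.injective _),
      ⟨⟨w, ?_⟩⟩⟩
    intro i j
    exact (e.map_adj_iff (v := w i) (w := w j)).symm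
  refine hle.trans ((mapProb_exists_le _).trans ?_)
  refine (Finset.sum_le_card_nsmul _ _ (indDensity F G) fun e _ => ?_).trans_eq ?_
  · have := mapMean_comp_injective hG0 e.injective fun f => if P f then (1 : ℝ) else 0
    refine le_trans (le_of_eq ?_) hP
    unfold mapProb
    convert this
  · rw [nsmul_eq_mul, Finset.card_univ]

theorem tendsto_mapProb_embedding {W : Type*} [Fintype W] (F : SimpleGraph W) {Γ : GraphLimit}
    (hF : tInd F Γ = 0) {G : ℕ → FiniteGraph} (hG : ConvergesTo G Γ) (N : ℕ) :
    Tendsto (fun n => mapProb fun φ : Fin N → Fin (G n).order => Function.Injective φ ∧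
      Nonempty (F ↪g (sampleGraph (G n) φ).graph)) atTop (𝓝 0) := by
  have h := (tendsto_indDensity F Γ G hG).const_mul
    (Fintype.card (Fin (Fintype.card W) ↪ Fin N) : ℝ)
  rw [hF, mul_zero] at h
  refine squeeze_zero' (Eventually.of_forall fun n => mapProb_nonneg _) ?_ h
  filter_upwards [hG.1.eventually_ge_atTop (Fintype.card W), hG.1.eventually_gt_atTop 0]
    with n hn hn0
  exact mapProb_embedding_le F (G n) N hn hn0

end Sampling

/-! ### Passage to graph limits. -/

section LimitTheorem

theorem tInd_eq_zero_of_isEmpty {W : Type*} [Fintype W] (F : SimpleGraph W) {Γ : GraphLimit}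
    {G : ℕ → FiniteGraph} (hG : ConvergesTo G Γ) (h : ∀ n, IsEmpty (F ↪g (G n).graph)) :
    tInd F Γ = 0 := by
  refine tendsto_nhds_unique (tendsto_indDensity F Γ G hG) ?_
  refine tendsto_const_nhds.congr fun n => ?_
  have : IsEmpty {S : Finset (Fin (G n).order) // S.card = Fintype.card W ∧
      Nonempty ((G n).graph.induce (S : Set (Fin (G n).order)) ≃g F)} :=
    ⟨fun ⟨_, _, ⟨e⟩⟩ => (h n).false (e.symm.toEmbedding.trans (SimpleGraph.Embedding.induce _))⟩
  simp [indDensity]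

/-- If the forbidden graphs have density zero in `Γ`, then a large random sample from a sequence
that converges to `Γ` can be chosen to be a unit interval graph close to `Γ`. -/
theorem exists_unitIntervalGraph_near {Γ : GraphLimit}
    (hcycle : ∀ k : ℕ, 4 ≤ k → tInd (SimpleGraph.cycleGraph k) Γ = 0)
    (hclaw : tInd (completeBipartiteGraph (Fin 1) (Fin 3)) Γ = 0)
    (hnet : tInd graphS3 Γ = 0) (hsun : tInd graphS3ᶜ Γ = 0) (m : ℕ) :
    ∃ H : FiniteGraph, m ≤ H.order ∧ IsUnitIntervalGraph H.graph ∧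
      ∀ F : FiniteGraph, F.order ≤ m → |homDensity F H - Γ.t F| ≤ 2 / (m + 1) := by
  classical
  obtain ⟨G, hG⟩ : ∃ G, ConvergesTo G Γ := Γ.exists_seq
  -- All graphs of order at most `m`: finitely many densities to control. Sampling and convergence
  -- each contribute at most `ε`.
  let A := Σ k : Fin (m + 1), SimpleGraph (Fin k)
  let _ : Fintype A := Fintype.ofFinite A
  let F : A → FiniteGraph := fun i => ⟨i.1, i.2⟩
  set ε : ℝ := 1 / (m + 1) with hε
  have hε0 : 0 < ε := by positivity
  have hvar : Tendsto (fun N => ∑ i : A, mapProb (fun s : Fin (F i).order ⊕ Fin (F i).order →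
      Fin N => ¬ Function.Injective s) / ε ^ 2) atTop (𝓝 0) := by
    have := tendsto_finsetSum (Finset.univ : Finset A) fun i _ =>
      (tendsto_mapProb_not_injective (κ := Fin (F i).order ⊕ Fin (F i).order)).div_const (ε ^ 2)
    simpa using this
  -- `N` can be fixed before `n`, since the variance bound does not involve `G n`.
  obtain ⟨N, hN, hmN, hN0⟩ := ((hvar.eventually_lt_const (show (0 : ℝ) < 1 / 2 by norm_num)).and
    ((eventually_ge_atTop m).and (eventually_gt_atTop 0))).exists
  -- Cycles on more than `N` vertices do not fit into the sample, so finitely many cycles suffice.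
  let bad : ∀ n, (Fin N → Fin (G n).order) → Prop := fun n φ =>
    ((((¬ Function.Injective φ) ∨ ∃ k : Fin (N + 1), Function.Injective φ ∧
        Nonempty (SimpleGraph.cycleGraph (k + 4) ↪g (sampleGraph (G n) φ).graph)) ∨
      (Function.Injective φ ∧
        Nonempty (completeBipartiteGraph (Fin 1) (Fin 3) ↪g (sampleGraph (G n) φ).graph))) ∨
      (Function.Injective φ ∧ Nonempty (graphS3 ↪g (sampleGraph (G n) φ).graph))) ∨
      (Function.Injective φ ∧ Nonempty (graphS3ᶜ ↪g (sampleGraph (G n) φ).graph))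
  have hbad : Tendsto (fun n => mapProb (bad n)) atTop (𝓝 0) := by
    have h1 := (tendsto_mapProb_not_injective (κ := Fin N)).comp hG.1
    have h2 := tendsto_finsetSum (Finset.univ : Finset (Fin (N + 1))) fun k _ =>
      tendsto_mapProb_embedding (SimpleGraph.cycleGraph (k + 4)) (hcycle _ (by omega)) hG N
    have h3 := tendsto_mapProb_embedding _ hclaw hG N
    have h4 := tendsto_mapProb_embedding _ hnet hG N
    have h5 := tendsto_mapProb_embedding _ hsun hG N
    have h := (((h1.add h2).add h3).add h4).add h5
    simp only [Finset.sum_const_zero, add_zero] at h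
    refine squeeze_zero (fun n => mapProb_nonneg _) (fun n => ?_) h
    refine (mapProb_or_le _ _).trans (add_le_add_left ?_ _)
    refine (mapProb_or_le _ _).trans (add_le_add_left ?_ _)
    refine (mapProb_or_le _ _).trans (add_le_add_left ?_ _)
    exact (mapProb_or_le _ _).trans (add_le_add_right (mapProb_exists_le _) _)
  have hclose : ∀ᶠ n in atTop, ∀ i : A, |homDensity (F i) (G n) - Γ.t (F i)| < ε :=
    eventually_all.2 fun i => by
      have := (hG.2 (F i)).eventually (Metric.ball_mem_nhds _ hε0)
      simpa [Real.dist_eq] using this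
  obtain ⟨n, hn, hnF, hn0⟩ :=
    ((hbad.eventually_lt_const (show (0 : ℝ) < 1 / 2 by norm_num)).and
    (hclose.and (hG.1.eventually_gt_atTop 0))).exists
  have hdev : mapProb (fun φ : Fin N → Fin (G n).order => ∃ i : A,
      ε ≤ |homDensity (F i) (sampleGraph (G n) φ) - homDensity (F i) (G n)|) < 1 / 2 := by
    refine (mapProb_exists_le _).trans_lt (lt_of_le_of_lt (Finset.sum_le_sum fun i _ => ?_) hN)
    refine (mapProb_le_of_sq hε0).trans ?_
    gcongr
    exact mapMean_sq_homDensity_sub_le (F i) (G n) hN0 hn0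
  -- Each of the two failures has probability below one half.
  obtain ⟨φ, hφ⟩ := exists_not_of_mapProb_lt_one hn0
    (lt_of_le_of_lt (mapProb_or_le (bad n) _) (by linarith [hdev]))
  simp only [bad, not_or, not_exists, not_and, not_not, not_nonempty_iff, not_le] at hφ
  obtain ⟨⟨⟨⟨⟨hinj, hc⟩, hk⟩, hs⟩, hs'⟩, hd⟩ := hφ
  refine ⟨sampleGraph (G n) φ, hmN, ?_, fun F' hF' => ?_⟩
  · refine IsForbiddenFree.isUnitIntervalGraph ⟨fun k hk4 => ⟨fun e => ?_⟩, hk hinj, hs hinj,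
      hs' hinj⟩
    have hkN : k ≤ N := by
      have hle : k ≤ (sampleGraph (G n) φ).order := by
        simpa using Fintype.card_le_of_injective e e.injective
      exact hle
    obtain ⟨l, rfl⟩ : ∃ l, k = l + 4 := ⟨k - 4, by omega⟩
    exact (hc ⟨l, by omega⟩ hinj).false e
  · let i : A := ⟨⟨F'.order, by omega⟩, F'.graph⟩
    have h1 := (hd i).le
    have h2 := (hnF i).le
    have h3 : (2 : ℝ) / (m + 1) = ε + ε := by rw [hε]; ring
    rw [h3]
    exact (abs_sub_le _ (homDensity F' (G n)) _).trans (add_le_add h1 h2)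

end LimitTheorem

end IntervalLimits

theorem theorem10p3 (Γ : IntervalLimits.GraphLimit) :
    IntervalLimits.IsUnitIntervalGraphLimit Γ ↔
      (∀ k : ℕ, 4 ≤ k → IntervalLimits.tInd (SimpleGraph.cycleGraph k) Γ = 0) ∧
      IntervalLimits.tInd (completeBipartiteGraph (Fin 1) (Fin 3)) Γ = 0 ∧
      IntervalLimits.tInd IntervalLimits.graphS3 Γ = 0 ∧
      IntervalLimits.tInd IntervalLimits.graphS3ᶜ Γ = 0 := by
  open IntervalLimits in
  constructor
  · rintro ⟨G, hunit, hG⟩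
    have key : ∀ {W : Type} [Fintype W] (F : SimpleGraph W), ¬ IsUnitIntervalGraph F →
        tInd F Γ = 0 := fun F hF =>
      tInd_eq_zero_of_isEmpty F hG fun n => ⟨fun e => hF ((hunit n).of_embedding e)⟩
    exact ⟨fun k hk => key _ (not_isUnitIntervalGraph_cycleGraph hk),
      key _ not_isUnitIntervalGraph_claw, key _ not_isUnitIntervalGraph_graphS3,
      key _ not_isUnitIntervalGraph_graphS3_compl⟩
  · rintro ⟨hcycle, hclaw, hnet, hsun⟩
    choose H hord hunit hnear using exists_unitIntervalGraph_near hcycle hclaw hnet hsun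
    refine ⟨H, hunit, tendsto_atTop_mono hord tendsto_id, fun F => ?_⟩
    rw [tendsto_iff_dist_tendsto_zero]
    have hlim : Tendsto (fun m : ℕ => (2 : ℝ) / (m + 1)) atTop (𝓝 0) := by
      have := (tendsto_one_div_add_atTop_nhds_zero_nat (𝕜 := ℝ)).const_mul 2
      simpa only [mul_one_div, mul_zero] using this
    refine squeeze_zero' (Eventually.of_forall fun _ => dist_nonneg) ?_ hlim
    -- The `m`-th graph controls only densities of graphs of order at most `m`, which includes a
    -- fixed `F` eventually.
    filter_upwards [eventually_ge_atTop F.order] with m hm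
    rw [Real.dist_eq]
    exact hnear m F hm
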